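/- Let $n\in\mathbb N$, let $\mathbb F_n^+$ be the free semigroup on $g_1,\dots,g_n$ with identity $g_0$, and let $F^2(H_n)$ be the full Fock space with orthonormal basis $\{e_\alpha\}_{\alpha\in\mathbb F_n^+}$ and $e_{g_0}=1$. Let $\boldsymbol\mu=\{\mu_\beta\}_{|\beta|\ge1}$ be strictly positive numbers, and put $\boldsymbol\mu(g_0,g_0)=1$ and $\boldsymbol\mu(g_i\alpha,g_0)=\mu_{g_i\alpha}\,\boldsymbol\mu(\alpha,g_0)$. Assume that, for each $i$, $$\sup_{\alpha}\mu_{g_i\alpha}<\infty,\qquad \sup_\alpha \frac{\boldsymbol\mu(\alpha g_i,g_0)}{\boldsymbol\mu(\alpha,g_0)}<\infty .$$ Let $W_ie_\alpha=\mu_{g_i\alpha}e_{g_i\alpha}$ be the weighted left shifts. For $\lambda\in\mathbb C^n$ write $\lambda_\alpha=\lambda_{i_1}\cdots\lambda_{i_p}$ if $\alpha=g_{i_1}\cdots g_{i_p}$, $\lambda_{g_0}=1$. Let $\mathcal D(\boldsymbol\mu)$ be the set of all $\lambda\in\mathbb C^n$ for which evaluation at $\lambda$, $p=\sum c_\alpha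 Z_\alpha\mapsto\sum c_\alpha\lambda_\alpha$, is bounded on the polynomials in noncommuting indeterminates $Z_1,\dots,Z_n$ with respect to the norm $\|p\|^2=\sum_\alpha\boldsymbol\mu(\alpha,g_0)^2|c_\alpha|^2$. Assume that $\mathcal D(\boldsymbol\mu)$ contains a neighbourhood of $0$. For $\mathbf k\in\mathbb N_0^n$ let $\Lambda_{\mathbf k}$ be the set of words $\alpha$ with $\lambda_\alpha=\lambda^{\mathbf k}$ for all $\lambda\in\mathbb C^n$, and put $$\omega_{\mathbf k}=\sum_{\alpha\in\Lambda_{\mathbf k}}\frac1{\boldsymbol\mu(\alpha,g_0)^2},\qquad y^{(\mathbf k)}=\frac1{\omega_{\mathbf k}}\sum_{\alpha\in\Lambda_{\mathbf k}}\frac1{\boldsymbol\mu(\alpha,g_0)}e_\alpha .$$ Let $F_s^2(\boldsymbol\mu)$ be the closed span of the vectors $y^{(\mathbf k)}$ in $F^2(H_n)$, let $B_i=P_{F_s^2(\boldsymbol\mu)}W_i|_{F_s^2(\boldsymbol\mu)}$ and $B^{\mathbf k}=B_1^{k_1}\cdots B_n^{k_n}$, and let $F_s^\infty(\boldsymbol\mu)$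 be the $w^*$-closed (non-self-adjoint) subalgebra of $B(F_s^2(\boldsymbol\mu))$ generated by $B_1,\dots,B_n$ and the identity. Let $\mathbb H^2(\mathcal D(\boldsymbol\mu))$ be the reproducing kernel Hilbert space of all functions $\varphi(\lambda)=\sum_{\mathbf k}c_{\mathbf k}\lambda^{\mathbf k}$ on $\mathcal D(\boldsymbol\mu)$ with $\|\varphi\|^2=\sum_{\mathbf k}|c_{\mathbf k}|^2/\omega_{\mathbf k}<\infty$. Let $\mathcal M$ be its multiplier algebra, i.e. the algebra of all functions $\varphi:\mathcal D(\boldsymbol\mu)\to\mathbb C$ with $\varphi\,\mathbb H^2(\mathcal D(\boldsymbol\mu))\subset\mathbb H^2(\mathcal D(\boldsymbol\mu))$, where $M_\varphi f=\varphi f$ and $\varphi$ has the multiplier norm $\|M_\varphi\|$. A formal series $\sum_{\mathbf k}c_{\mathbf k}B^{\mathbf k}$ is called the Fourier representation of $A\in B(F_s^2(\boldsymbol\mu))$ if $A1=\sum_{\mathbf k}c_{\mathbf k}y^{(\mathbf k)}$. Then there are a unitary operator $U:F_s^2(\boldsymbol\mu)\to\mathbb H^2(\mathcal D(\boldsymbol\mu))$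 with $Uy^{(\mathbf k)}=\lambda^{\mathbf k}$ for all $\mathbf k\in\mathbb N_0^n$, and an isometric algebra isomorphism $\Psi$ of $F_s^\infty(\boldsymbol\mu)$ onto $\mathcal M$, such that $UAU^*=M_{\Psi(A)}$ for all $A\in F_s^\infty(\boldsymbol\mu)$, and $\Psi(B_i)$ is the coordinate function $\lambda_i$ for each $i$. Moreover, each $A\in F_s^\infty(\boldsymbol\mu)$ has a unique Fourier representation $\sum_{\mathbf k}c_{\mathbf k}B^{\mathbf k}$, and is uniquely determined by it. It satisfies $Ay^{(\mathbf p)}=\sum_{\mathbf k}c_{\mathbf k}B^{\mathbf k}y^{(\mathbf p)}$ for all $\mathbf p\in\mathbb N_0^n$ and $\Psi(A)(\lambda)=\sum_{\mathbf k}c_{\mathbf k}\lambda^{\mathbf k}$ for all $\lambda\in\mathcal D(\boldsymbol\mu)$, and $$A=\text{SOT-}\lim_{N\to\infty}\sum_{\mathbf k\in\mathbb N_0^n,\ |\mathbf k|\le N}\Bigl(1-\frac{|\mathbf k|}{N+1}\Bigr)c_{\mathbf k}B^{\mathbf k}.$$ -/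

import Mathlib

open scoped Topology ENNReal InnerProductSpace

noncomputable section

namespace WeightedFock

/-! ### Words, weights and the weighted left multi-shift

The free semigroup on generators `g_1, …, g_n` is modelled by `List (Fin n)`: the identity `g_0`
is `[]`, and `g_i α` is `i :: α`. -/

/-- `𝛍(α, g_0) = μ_{g_{i_1} ⋯ g_{i_p}} μ_{g_{i_2} ⋯ g_{i_p}} ⋯ μ_{g_{i_p}}` for
`α = g_{i_1} ⋯ g_{i_p}`, and `𝛍(g_0, g_0) = 1`. -/
def weightProd {n : ℕ} (μ : List (Fin n) → ℝ) : List (Fin n) → ℝ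
  | [] => 1
  | i :: α => μ (i :: α) * weightProd μ α

/-- Weight sequences `{μ_β}_{|β| ≥ 1}` of strictly positive numbers for which the left and the
right multiplications by the indeterminates are bounded. The value at the empty word is never
used. -/
structure WeightSequence (n : ℕ) where
  /-- the weights -/
  toFun : List (Fin n) → ℝ
  pos : ∀ i α, 0 < toFun (i :: α)
  bddAbove_left : ∀ i, BddAbove (Set.range fun α => toFun (i :: α))
  bddAbove_right : ∀ i, BddAbove
    (Set.range fun α => weightProd toFun (α ++ [i]) / weightProd toFun α)

/-- The full Fock space `F²(H_n)`, realized on its orthonormal basis `e_α`. -/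
abbrev Fock (n : ℕ) : Type := lp (fun _ : List (Fin n) => ℂ) 2

/-- The basis vector `e_α`. -/
def e {n : ℕ} (α : List (Fin n)) : Fock n := lp.single 2 α 1

/-- The left creation operator, `S_i e_α = e_{g_i α}`. -/
def creation {n : ℕ} (i : Fin n) : Fock n →L[ℂ] Fock n :=
  LinearMap.mkContinuous
    { toFun := fun f => ⟨Function.extend (List.cons i) f 0, by
        have hi : Function.Injective (List.cons i) := List.cons_injective
        refine memℓp_gen ?_
        rw [← hi.summable_iff]
        · simpa [Function.comp_def, hi.extend_apply] using (lp.memℓp f).summable (by simp)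
        · intro β hβ
          rw [Function.extend_apply' _ _ _ (by simpa using hβ)]
          simp⟩
      map_add' := fun f g => by
        have hi : Function.Injective (List.cons i) := List.cons_injective
        ext β
        change Function.extend (List.cons i) (fun α => f α + g α) 0 β =
          Function.extend (List.cons i) f 0 β + Function.extend (List.cons i) g 0 β
        by_cases h : ∃ α, i :: α = β
        · obtain ⟨α, rfl⟩ := h
          simp only [hi.extend_apply]
        · simp [Function.extend_apply' _ _ _ h]
      map_smul' := fun c f => by
        have hi : Function.Injective (List.cons i) := List.cons_injective
        ext β
        change Function.extend (List.cons i) (fun α => c * f α) 0 β =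
          c * Function.extend (List.cons i) f 0 β
        by_cases h : ∃ α, i :: α = β
        · obtain ⟨α, rfl⟩ := h
          simp only [hi.extend_apply]
        · simp [Function.extend_apply' _ _ _ h] } 1 (fun f => by
      have hi : Function.Injective (List.cons i) := List.cons_injective
      rw [one_mul]
      refine lp.norm_le_of_tsum_le (by simp) (norm_nonneg _) ?_
      rw [lp.norm_rpow_eq_tsum (by simp) f, ← hi.tsum_eq]
      · simp
      · intro β hβ
        by_contra h
        apply hβ
        simp [Function.extend_apply' _ _ _ (by simpa using h)])

theorem creation_e {n : ℕ} (i : Fin n) (α : List (Fin n)) : creation i (e α) = e (i :: α) := by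
  have hi : Function.Injective (List.cons i) := List.cons_injective
  ext β
  change Function.extend (List.cons i) (e α) 0 β = _
  by_cases h : ∃ γ, i :: γ = β
  · obtain ⟨γ, rfl⟩ := h
    rw [hi.extend_apply]
    by_cases hγ : γ = α
    · subst hγ; simp [e]
    · simp [e, lp.single_apply, hγ]
  · rw [Function.extend_apply' _ _ _ h]
    have : β ≠ i :: α := fun hh => h ⟨α, hh.symm⟩
    simp [e, lp.single_apply, this]

namespace WeightSequence

variable {n : ℕ} (μ : WeightSequence n)

/-- `𝛍(α, g_0)`. -/
abbrev prod (α : List (Fin n)) : ℝ := weightProd μ.toFun α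

theorem prod_pos (α : List (Fin n)) : 0 < μ.prod α := by
  induction α with
  | nil => simp [prod, weightProd]
  | cons i α ih => exact mul_pos (μ.pos i α) ih

/-- The diagonal operator, `D_i e_α = μ_{g_i α} e_α`. -/
def diag (i : Fin n) : Fock n →L[ℂ] Fock n :=
  LinearMap.mkContinuousOfExistsBound
    { toFun := fun f => ⟨fun α => (μ.toFun (i :: α) : ℂ) * f α, by
        obtain ⟨M, hM⟩ := μ.bddAbove_left i
        refine Memℓp.mono (g := fun α => M * ‖f α‖) ?_ ?_
        · have := ((lp.memℓp f).norm).const_mul M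
          simpa using this
        · intro α
          have h1 : μ.toFun (i :: α) ≤ M := hM ⟨α, rfl⟩
          have h2 := (μ.pos i α).le
          simp only [norm_mul, Complex.norm_real, Real.norm_eq_abs, abs_of_nonneg h2]
          gcongr⟩
      map_add' := fun f g => by ext α; exact mul_add _ _ _
      map_smul' := fun c f => by ext α; simp; ring }
    (by
      obtain ⟨M, hM⟩ := μ.bddAbove_left i
      have hM0 : 0 ≤ M := (μ.pos i []).le.trans (hM ⟨[], rfl⟩)
      refine ⟨M, fun f => ?_⟩
      have h : M * ‖f‖ = ‖(M : ℂ) • f‖ := by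
        rw [norm_smul, Complex.norm_real, Real.norm_of_nonneg hM0]
      rw [h]
      refine lp.norm_mono (by simp) fun α => ?_
      have h1 : μ.toFun (i :: α) ≤ M := hM ⟨α, rfl⟩
      have h2 := (μ.pos i α).le
      simp only [LinearMap.coe_mk, AddHom.coe_mk, lp.coeFn_smul, Pi.smul_apply, smul_eq_mul,
        norm_mul, Complex.norm_real, Real.norm_of_nonneg h2, Real.norm_of_nonneg hM0]
      gcongr)

theorem diag_e (i : Fin n) (α : List (Fin n)) :
    μ.diag i (e α) = (μ.toFun (i :: α) : ℂ) • e α := by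
  ext β
  change (μ.toFun (i :: β) : ℂ) * (e α : Fock n) β = (μ.toFun (i :: α) : ℂ) * (e α : Fock n) β
  by_cases h : β = α
  · rw [h]
  · simp [e, lp.single_apply, h]

/-- The weighted left creation operators `W_i = S_i D_i`. -/
def W (i : Fin n) : Fock n →L[ℂ] Fock n := creation i ∘L μ.diag i

theorem W_e (i : Fin n) (α : List (Fin n)) :
    μ.W i (e α) = (μ.toFun (i :: α) : ℂ) • e (i :: α) := by
  simp only [W, ContinuousLinearMap.comp_apply, diag_e, map_smul, creation_e]

end WeightSequence

/-! ### Monomials and the sets `Λ_k` -/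

/-- `λ_α = λ_{j_1} ⋯ λ_{j_m}` for `α = g_{j_1} ⋯ g_{j_m}`. -/
def evalWord {n : ℕ} (z : Fin n → ℂ) (α : List (Fin n)) : ℂ := (α.map z).prod

/-- `λ^k = λ_1^{k_1} ⋯ λ_n^{k_n}`. -/
def monomial {n : ℕ} (z : Fin n → ℂ) (k : Fin n → ℕ) : ℂ := ∏ i, z i ^ k i

theorem evalWord_eq {n : ℕ} (z : Fin n → ℂ) (α : List (Fin n)) :
    evalWord z α = monomial z (fun i => α.count i) := by
  simp only [evalWord, monomial]
  rw [Finset.prod_list_map_count]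
  refine Finset.prod_subset (Finset.subset_univ _) fun i _ hi => ?_
  rw [List.count_eq_zero_of_not_mem (by simpa using hi), pow_zero]

theorem monomial_injective {n : ℕ} {k l : Fin n → ℕ}
    (h : ∀ z : Fin n → ℂ, monomial z k = monomial z l) : k = l := by
  ext i
  have := h (Function.update 1 i 2)
  simp only [monomial] at this
  rw [Finset.prod_eq_single i (by intro j _ hj; simp [hj]) (by simp),
    Finset.prod_eq_single i (by intro j _ hj; simp [hj]) (by simp)] at this
  simp only [Function.update_self] at this
  have h2 : (2 : ℕ) ^ k i = 2 ^ l i := by exact_mod_cast this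
  exact Nat.pow_right_injective le_rfl h2

/-- `Λ_k`, the words `α` with `λ_α = λ^k` for all `λ ∈ ℂ^n`. -/
def Lam {n : ℕ} (k : Fin n → ℕ) : Set (List (Fin n)) :=
  {α | ∀ z : Fin n → ℂ, evalWord z α = monomial z k}

theorem mem_Lam {n : ℕ} {k : Fin n → ℕ} {α : List (Fin n)} :
    α ∈ Lam k ↔ (fun i => α.count i) = k := by
  constructor
  · intro h
    exact monomial_injective fun z => by rw [← evalWord_eq, h z]
  · rintro rfl z
    exact evalWord_eq z α

theorem finite_Lam {n : ℕ} (k : Fin n → ℕ) : (Lam k).Finite := by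
  refine (List.finite_length_eq (Fin n) (∑ i, k i)).subset fun α hα => ?_
  rw [mem_Lam] at hα
  subst hα
  have := Multiset.sum_count_eq_card (s := Finset.univ) (m := (α : Multiset (Fin n))) (by simp)
  simpa using this.symm

/-- `Λ_k` as a finite set. -/
def LamFinset {n : ℕ} (k : Fin n → ℕ) : Finset (List (Fin n)) := (finite_Lam k).toFinset

theorem mem_LamFinset {n : ℕ} {k : Fin n → ℕ} {α : List (Fin n)} :
    α ∈ LamFinset k ↔ (fun i => α.count i) = k := by
  simp [LamFinset, mem_Lam]

theorem LamFinset_nonempty {n : ℕ} (k : Fin n → ℕ) : (LamFinset k).Nonempty := by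
  refine ⟨(∑ i, k i • ({i} : Multiset (Fin n))).toList, ?_⟩
  rw [mem_LamFinset]
  ext j
  rw [← Multiset.coe_count, Multiset.coe_toList, Multiset.count_sum']
  simp [Multiset.count_singleton]

theorem LamFinset_zero {n : ℕ} : LamFinset (0 : Fin n → ℕ) = {[]} := by
  ext α
  rw [mem_LamFinset, Finset.mem_singleton]
  constructor
  · intro h
    refine List.eq_nil_iff_forall_not_mem.2 fun i hi => ?_
    have := congrFun h i
    simp only [Pi.zero_apply, List.count_eq_zero] at this
    exact this hi
  · rintro rfl
    ext
    simp

namespace WeightSequence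

variable {n : ℕ} (μ : WeightSequence n)

/-! ### The symmetric weighted Fock space and the compressions -/

/-- `ω_k = ∑_{α ∈ Λ_k} 1 / 𝛍(α, g_0)²`. -/
def ω (k : Fin n → ℕ) : ℝ := ∑ α ∈ LamFinset k, 1 / μ.prod α ^ 2

theorem ω_pos (k : Fin n → ℕ) : 0 < μ.ω k :=
  Finset.sum_pos (fun α _ => by have := μ.prod_pos α; positivity) (LamFinset_nonempty k)

/-- `y^{(k)} = ω_k⁻¹ ∑_{α ∈ Λ_k} 𝛍(α, g_0)⁻¹ e_α`, as a vector of the full Fock space. -/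
def yFock (k : Fin n → ℕ) : Fock n :=
  (1 / μ.ω k : ℂ) • ∑ α ∈ LamFinset k, (1 / μ.prod α : ℂ) • e α

/-- The symmetric weighted Fock space `F_s²(𝛍)`. -/
def symFock : Submodule ℂ (Fock n) :=
  (Submodule.span ℂ (Set.range μ.yFock)).topologicalClosure

instance : CompleteSpace μ.symFock :=
  inferInstanceAs
    (CompleteSpace (Submodule.span ℂ (Set.range μ.yFock)).topologicalClosure)

/-- `y^{(k)}` as a vector of `F_s²(𝛍)`. -/
def y (k : Fin n → ℕ) : μ.symFock :=
  ⟨μ.yFock k, Submodule.le_topologicalClosure _ (Submodule.subset_span ⟨k, rfl⟩)⟩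

/-- The vacuum vector `1 = e_{g_0}` is `y^{(0)}`. -/
theorem y_zero : (μ.y 0 : Fock n) = e [] := by
  simp [y, yFock, ω, LamFinset_zero, weightProd]

/-- `B_i = P_{F_s²(𝛍)} W_i |_{F_s²(𝛍)}`. -/
def B (i : Fin n) : μ.symFock →L[ℂ] μ.symFock :=
  μ.symFock.orthogonalProjectionOnto ∘L μ.W i ∘L μ.symFock.subtypeL

/-- `B^k = B_1^{k_1} ⋯ B_n^{k_n}`. -/
def Bpow (k : Fin n → ℕ) : μ.symFock →L[ℂ] μ.symFock :=
  ((List.finRange n).map fun i => μ.B i ^ k i).prod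

end WeightSequence

/-- The ultraweak (`w*`) topology of `B(H)`: the coarsest topology for which the functionals
`T ↦ ∑_j ⟨T x_j, y_j⟩` are continuous, for all square summable sequences `(x_j)`, `(y_j)`. -/
@[reducible] def ultraweakTopology (H : Type*) [NormedAddCommGroup H] [InnerProductSpace ℂ H] :
    TopologicalSpace (H →L[ℂ] H) :=
  ⨅ (x : lp (fun _ : ℕ => H) 2) (y : lp (fun _ : ℕ => H) 2),
    TopologicalSpace.induced (fun T => ∑' j, ⟪y j, T (x j)⟫_ℂ) inferInstance

namespace WeightSequence

variable {n : ℕ} (μ : WeightSequence n)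

/-- The Hardy algebra `F_s^∞(𝛍)`: the `w*`-closed algebra generated by `B_1, …, B_n` and the
identity. -/
def hardyAlgebra : Subalgebra ℂ (μ.symFock →L[ℂ] μ.symFock) :=
  sInf {A | (∀ i, μ.B i ∈ A) ∧
    IsClosed[ultraweakTopology μ.symFock] (A : Set (μ.symFock →L[ℂ] μ.symFock))}

theorem B_mem (i : Fin n) : μ.B i ∈ μ.hardyAlgebra :=
  Algebra.mem_sInf.2 fun _ hA => hA.1 i

/-! ### The domain `D(𝛍)` and the function space `H²(D(𝛍))` -/

/-- `D(𝛍)`: the points `λ` such that `p ↦ p(λ)`, on the polynomials `p = ∑ c_α Z_α` in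
noncommuting indeterminates, is bounded for the norm `‖p‖² = ∑ 𝛍(α, g_0)² |c_α|²`. -/
def domain : Set (Fin n → ℂ) :=
  {z | ∃ C : ℝ, ∀ p : List (Fin n) →₀ ℂ,
    ‖p.sum fun α c => c * evalWord z α‖ ≤ C * √(p.sum fun α c => μ.prod α ^ 2 * ‖c‖ ^ 2)}

theorem norm_sum_le {z : Fin n → ℂ} {C : ℝ} (hC : ∀ p : List (Fin n) →₀ ℂ,
    ‖p.sum fun α c => c * evalWord z α‖ ≤ C * √(p.sum fun α c => μ.prod α ^ 2 * ‖c‖ ^ 2))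
    (c : (Fin n → ℕ) → ℂ) (K : Finset (Fin n → ℕ)) :
    ‖∑ k ∈ K, c k * monomial z k‖ ≤ C * √(∑ k ∈ K, ‖c k‖ ^ 2 / μ.ω k) := by
  have hdisj : (K : Set (Fin n → ℕ)).PairwiseDisjoint LamFinset := by
    intro k _ l _ hkl
    refine Finset.disjoint_left.2 fun α h1 h2 => hkl ?_
    rw [← mem_LamFinset.1 h1, ← mem_LamFinset.1 h2]
  let f : List (Fin n) → ℂ := fun α => if α ∈ K.biUnion LamFinset then
    c (fun i => α.count i) / (μ.ω (fun i => α.count i) * μ.prod α ^ 2 : ℝ) else 0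
  have hf : ∀ k ∈ K, ∀ α ∈ LamFinset k, f α = c k / (μ.ω k * μ.prod α ^ 2 : ℝ) := by
    intro k hk α hα
    have h1 : α ∈ K.biUnion LamFinset := Finset.mem_biUnion.2 ⟨k, hk, hα⟩
    have h2 := mem_LamFinset.1 hα
    simp only [f, h1, if_true, h2]
  have key := hC (Finsupp.onFinset (K.biUnion LamFinset) f
    (fun α h => by by_contra h'; exact h (if_neg h')))
  rw [Finsupp.onFinset_sum _ (by simp), Finsupp.onFinset_sum _ (by simp),
    Finset.sum_biUnion hdisj, Finset.sum_biUnion hdisj] at key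
  have e1 : ∀ k ∈ K, ∑ α ∈ LamFinset k, f α * evalWord z α = c k * monomial z k := by
    intro k hk
    have h0 : ((μ.ω k : ℝ) : ℂ) ≠ 0 := by exact_mod_cast (μ.ω_pos k).ne'
    have : ∀ α ∈ LamFinset k, f α * evalWord z α =
        c k * monomial z k / (μ.ω k : ℝ) * ((1 / μ.prod α ^ 2 : ℝ) : ℂ) := by
      intro α hα
      rw [hf k hk α hα, evalWord_eq, mem_LamFinset.1 hα]
      push_cast
      field_simp
    rw [Finset.sum_congr rfl this, ← Finset.mul_sum, ← Complex.ofReal_sum]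
    change _ * ((μ.ω k : ℝ) : ℂ) = _
    field_simp
  have e2 : ∀ k ∈ K, ∑ α ∈ LamFinset k, μ.prod α ^ 2 * ‖f α‖ ^ 2 = ‖c k‖ ^ 2 / μ.ω k := by
    intro k hk
    have h0 := μ.ω_pos k
    have : ∀ α ∈ LamFinset k, μ.prod α ^ 2 * ‖f α‖ ^ 2 =
        ‖c k‖ ^ 2 / μ.ω k ^ 2 * (1 / μ.prod α ^ 2) := by
      intro α hα
      have h3 := μ.prod_pos α
      rw [hf k hk α hα, norm_div, Complex.norm_real, Real.norm_of_nonneg (by positivity)]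
      field_simp
    rw [Finset.sum_congr rfl this, ← Finset.mul_sum]
    change _ * μ.ω k = _
    field_simp
  rwa [Finset.sum_congr rfl e1, Finset.sum_congr rfl e2] at key

/-- `φ(λ) = ∑_k c_k λ^k` on `D(𝛍)` with `∑_k |c_k|² / ω_k < ∞`. -/
def IsPowerSeries (c : (Fin n → ℕ) → ℂ) (φ : μ.domain → ℂ) : Prop :=
  Summable (fun k => ‖c k‖ ^ 2 / μ.ω k) ∧
    ∀ z : μ.domain, HasSum (fun k => c k * monomial z.1 k) (φ z)

theorem IsPowerSeries.add {c d : (Fin n → ℕ) → ℂ} {φ ψ : μ.domain → ℂ}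
    (h : μ.IsPowerSeries c φ) (h' : μ.IsPowerSeries d ψ) :
    μ.IsPowerSeries (c + d) (φ + ψ) := by
  refine ⟨?_, fun z => ?_⟩
  · refine Summable.of_nonneg_of_le (fun k => ?_) (fun k => ?_)
      ((h.1.mul_left 2).add (h'.1.mul_left 2))
    · have := μ.ω_pos k
      positivity
    · have h0 := μ.ω_pos k
      rw [Pi.add_apply, ← mul_div_assoc, ← mul_div_assoc, ← add_div]
      gcongr
      have h1 := norm_add_le (c k) (d k)
      nlinarith [sq_nonneg (‖c k‖ - ‖d k‖), norm_nonneg (c k + d k)]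
  · simpa [add_mul] using (h.2 z).add (h'.2 z)

theorem IsPowerSeries.smul (a : ℂ) {c : (Fin n → ℕ) → ℂ} {φ : μ.domain → ℂ}
    (h : μ.IsPowerSeries c φ) : μ.IsPowerSeries (a • c) (a • φ) := by
  refine ⟨?_, fun z => ?_⟩
  · simpa [mul_pow, mul_div_assoc] using h.1.mul_left (‖a‖ ^ 2)
  · simpa [mul_assoc] using (h.2 z).mul_left a

theorem eq_zero_of_hasSum (hD : μ.domain ∈ 𝓝 0) {c : (Fin n → ℕ) → ℂ}
    (h : ∀ z : μ.domain, HasSum (fun k => c k * monomial z.1 k) 0) : c = 0 := by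
  obtain ⟨r, hr, hrD⟩ := Metric.nhds_basis_closedBall.mem_iff.1 hD
  -- the homogeneous parts vanish on a polydisc
  have hom : ∀ (x : Fin n → ℂ), (∀ i, ‖x i‖ ≤ r) → ∀ m : ℕ,
      ∑ k ∈ Finset.piAntidiag Finset.univ m, c k * monomial x k = 0 := by
    intro x hx
    have hs : ∀ t : ℂ, ‖t‖ ≤ 1 → HasSum (fun m : ℕ =>
        t ^ m * ∑ k ∈ Finset.piAntidiag Finset.univ m, c k * monomial x k) 0 := by
      intro t ht
      have hmem : t • x ∈ μ.domain := hrD (by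
        rw [mem_closedBall_zero_iff, pi_norm_le_iff_of_nonneg hr.le]
        intro i
        rw [Pi.smul_apply, smul_eq_mul, norm_mul]
        nlinarith [hx i, norm_nonneg (x i), norm_nonneg t])
      have h1 := h ⟨t • x, hmem⟩
      have h2 := h1.tsum_fiberwise (fun k => ∑ i, k i)
      refine Eq.mpr (congrArg (fun F : ℕ → ℂ => HasSum F 0) (funext fun m => ?_)) h2
      have hset : (fun k : Fin n → ℕ => ∑ i, k i) ⁻¹' {m} =
          ((Finset.piAntidiag Finset.univ m : Finset (Fin n → ℕ)) : Set (Fin n → ℕ)) := by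
        ext k
        simp
      rw [hset, Finset.tsum_subtype' (Finset.piAntidiag Finset.univ m)
        (fun k => c k * monomial (t • x) k), Finset.mul_sum]
      refine Finset.sum_congr rfl fun k hk => ?_
      have hk' : ∑ i, k i = m := by simpa using hk
      simp only [monomial, Pi.smul_apply, smul_eq_mul, mul_pow, Finset.prod_mul_distrib,
        Finset.prod_pow_eq_pow_sum, hk']
      ring
    have hp : HasFPowerSeriesAt (0 : ℂ → ℂ) (FormalMultilinearSeries.ofScalars ℂ
        (fun m : ℕ => ∑ k ∈ Finset.piAntidiag Finset.univ m, c k * monomial x k)) 0 := by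
      rw [hasFPowerSeriesAt_iff]
      filter_upwards [Metric.closedBall_mem_nhds (0 : ℂ) one_pos] with t ht
      simpa [FormalMultilinearSeries.coeff_ofScalars] using hs t (by simpa using ht)
    intro m
    rw [← FormalMultilinearSeries.coeff_ofScalars (𝕜 := ℂ) (p := fun m : ℕ =>
      ∑ k ∈ Finset.piAntidiag Finset.univ m, c k * monomial x k) (n := m), hp.eq_zero]
    rfl
  funext k
  let m := ∑ i, k i
  let P : MvPolynomial (Fin n) ℂ := ∑ l ∈ Finset.piAntidiag Finset.univ m,
    MvPolynomial.monomial (Finsupp.equivFunOnFinite.symm l) (c l)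
  have hP : P = 0 := by
    refine MvPolynomial.funext_set (fun _ => Metric.closedBall (0 : ℂ) r) (fun _ => ?_) ?_
    · exact infinite_of_mem_nhds (0 : ℂ) (Metric.closedBall_mem_nhds _ hr)
    · intro x hx
      have hx' : ∀ i, ‖x i‖ ≤ r := fun i => by simpa using hx i (Set.mem_univ i)
      have := hom x hx' m
      simp only [P, map_sum, map_zero, MvPolynomial.eval_monomial]
      rw [← this]
      refine Finset.sum_congr rfl fun l _ => ?_
      rw [Finsupp.prod_fintype _ _ (by simp)]
      simp [monomial]
  have hc := congrArg (MvPolynomial.coeff (Finsupp.equivFunOnFinite.symm k)) hP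
  simp only [P, MvPolynomial.coeff_sum, MvPolynomial.coeff_monomial, MvPolynomial.coeff_zero,
    EmbeddingLike.apply_eq_iff_eq, Finset.sum_ite_eq'] at hc
  simpa [m] using hc

theorem IsPowerSeries.unique (hD : μ.domain ∈ 𝓝 0) {c d : (Fin n → ℕ) → ℂ} {φ : μ.domain → ℂ}
    (h : μ.IsPowerSeries c φ) (h' : μ.IsPowerSeries d φ) : c = d := by
  rw [← sub_eq_zero]
  refine μ.eq_zero_of_hasSum hD fun z => ?_
  simpa [sub_mul] using (h.2 z).sub (h'.2 z)

/-- The functions on `D(𝛍)` with a power series representation as above. -/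
def hardySubmodule : Submodule ℂ (μ.domain → ℂ) where
  carrier := {φ | ∃ c, μ.IsPowerSeries c φ}
  add_mem' := by
    rintro φ ψ ⟨c, hc⟩ ⟨d, hd⟩
    exact ⟨c + d, hc.add μ hd⟩
  zero_mem' := ⟨0, by simp [IsPowerSeries, summable_zero, hasSum_zero]⟩
  smul_mem' := by
    rintro a φ ⟨c, hc⟩
    exact ⟨a • c, hc.smul μ a⟩

/-- The space `H²(D(𝛍))` of all functions `φ : D(𝛍) → ℂ` with a representation
`φ(λ) = ∑_k c_k λ^k`, `∑_k |c_k|² / ω_k < ∞`. It is a Hilbert space for the norm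
`‖φ‖² = ∑_k |c_k|² / ω_k`; the coefficients are unique since `D(𝛍)` is a neighbourhood of `0`. -/
def HardySpace (_hD : μ.domain ∈ 𝓝 0) : Type := μ.hardySubmodule

end WeightSequence

namespace HardySpace

variable {n : ℕ} {μ : WeightSequence n} {hD : μ.domain ∈ 𝓝 0}

instance : AddCommGroup (μ.HardySpace hD) := inferInstanceAs (AddCommGroup μ.hardySubmodule)

instance : Module ℂ (μ.HardySpace hD) := inferInstanceAs (Module ℂ μ.hardySubmodule)

/-- The underlying function on `D(𝛍)`. -/
def toFun : μ.HardySpace hD →ₗ[ℂ] (μ.domain → ℂ) := μ.hardySubmodule.subtype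

theorem toFun_injective : Function.Injective (toFun : μ.HardySpace hD →ₗ[ℂ] _) :=
  Subtype.val_injective

/-- The coefficients `c_k` of the power series of `f`. -/
def coeff (f : μ.HardySpace hD) : (Fin n → ℕ) → ℂ := Classical.choose f.2

theorem coeff_spec (f : μ.HardySpace hD) : μ.IsPowerSeries (coeff f) (toFun f) :=
  Classical.choose_spec f.2

theorem coeff_eq {f : μ.HardySpace hD} {c : (Fin n → ℕ) → ℂ}
    (h : μ.IsPowerSeries c (toFun f)) : coeff f = c :=
  (coeff_spec f).unique μ hD h

theorem memℓp_iff {c : (Fin n → ℕ) → ℂ} :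
    Memℓp (fun k => c k / √(μ.ω k)) 2 ↔ Summable (fun k => ‖c k‖ ^ 2 / μ.ω k) := by
  rw [memℓp_gen_iff (by simp)]
  refine summable_congr fun k => ?_
  simp [div_pow, Real.sq_sqrt (μ.ω_pos k).le, abs_of_nonneg (Real.sqrt_nonneg _)]

theorem isPowerSeries_of_summable {c : (Fin n → ℕ) → ℂ}
    (h : Summable (fun k => ‖c k‖ ^ 2 / μ.ω k)) : ∃ φ, μ.IsPowerSeries c φ := by
  have hs : ∀ z : μ.domain, Summable (fun k => c k * monomial z.1 k) := by
    rintro ⟨z, C, hC⟩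
    rw [summable_iff_vanishing_norm]
    intro ε hε
    have hC0 : (0 : ℝ) < |C| + 1 := by positivity
    obtain ⟨s, hs⟩ := summable_iff_vanishing_norm.1 h ((ε / (|C| + 1)) ^ 2) (by positivity)
    refine ⟨s, fun t ht => ?_⟩
    have h1 := hs t ht
    have h2 : 0 ≤ ∑ k ∈ t, ‖c k‖ ^ 2 / μ.ω k :=
      Finset.sum_nonneg fun k _ => by have := μ.ω_pos k; positivity
    rw [Real.norm_of_nonneg h2] at h1
    have h3 : √(∑ k ∈ t, ‖c k‖ ^ 2 / μ.ω k) < ε / (|C| + 1) := by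
      rw [Real.sqrt_lt' (by positivity)]
      exact h1
    calc ‖∑ k ∈ t, c k * monomial z k‖ ≤ C * √(∑ k ∈ t, ‖c k‖ ^ 2 / μ.ω k) :=
          μ.norm_sum_le hC c t
      _ ≤ (|C| + 1) * √(∑ k ∈ t, ‖c k‖ ^ 2 / μ.ω k) := by
          gcongr
          linarith [le_abs_self C]
      _ < (|C| + 1) * (ε / (|C| + 1)) := by gcongr
      _ = ε := by field_simp
  exact ⟨fun z => ∑' k, c k * monomial z.1 k, h, fun z => (hs z).hasSum⟩

/-- The normalized coefficients `c_k / √ω_k` identify `H²(D(𝛍))` with `ℓ²`. -/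
def equivLp : μ.HardySpace hD ≃ₗ[ℂ] lp (fun _ : Fin n → ℕ => ℂ) 2 :=
  LinearEquiv.ofBijective
    { toFun := fun f => ⟨fun k => coeff f k / √(μ.ω k), memℓp_iff.2 (coeff_spec f).1⟩
      map_add' := fun f g => by
        have : coeff (f + g) = coeff f + coeff g := coeff_eq (by
          rw [map_add]
          exact (coeff_spec f).add μ (coeff_spec g))
        ext k
        change coeff (f + g) k / _ = coeff f k / _ + coeff g k / _
        rw [this, Pi.add_apply, add_div]
      map_smul' := fun a f => by
        have : coeff (a • f) = a • coeff f := coeff_eq (by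
          rw [map_smul]
          exact (coeff_spec f).smul μ a)
        ext k
        change coeff (a • f) k / _ = a * (coeff f k / _)
        rw [this, Pi.smul_apply, smul_eq_mul, mul_div_assoc] }
    (by
      have hω : ∀ k, ((√(μ.ω k) : ℝ) : ℂ) ≠ 0 := fun k => by
        exact_mod_cast (Real.sqrt_pos.2 (μ.ω_pos k)).ne'
      constructor
      · intro f g hfg
        have h : coeff f = coeff g := by
          ext k
          have := congrArg (fun v : lp (fun _ : Fin n → ℕ => ℂ) 2 => v k) hfg
          exact (div_left_inj' (hω k)).1 this
        refine toFun_injective (funext fun z => ?_)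
        exact ((coeff_spec f).2 z).unique (h ▸ (coeff_spec g).2 z)
      · intro v
        have hv : (fun k => v k * √(μ.ω k) / √(μ.ω k)) = fun k => v k :=
          funext fun k => mul_div_cancel_right₀ _ (hω k)
        obtain ⟨φ, hφ⟩ := isPowerSeries_of_summable (μ := μ) (c := fun k => v k * √(μ.ω k))
          (memℓp_iff.1 (by rw [hv]; exact lp.memℓp v))
        refine ⟨⟨φ, _, hφ⟩, ?_⟩
        ext k
        change coeff (⟨φ, _, hφ⟩ : μ.HardySpace hD) k / _ = v k
        rw [coeff_eq (hD := hD) (f := ⟨φ, _, hφ⟩) hφ]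
        exact congrFun hv k)

instance : NormedAddCommGroup (μ.HardySpace hD) :=
  NormedAddCommGroup.induced _ _ (equivLp : μ.HardySpace hD ≃ₗ[ℂ] _) equivLp.injective

instance : InnerProductSpace ℂ (μ.HardySpace hD) where
  toNormedSpace := NormedSpace.induced ℂ _ _ (equivLp : μ.HardySpace hD ≃ₗ[ℂ] _)
  inner f g := ⟪equivLp f, equivLp g⟫_ℂ
  norm_sq_eq_re_inner f := norm_sq_eq_re_inner (𝕜 := ℂ) (equivLp f)
  conj_inner_symm f g := inner_conj_symm _ _
  add_left f g h := by rw [map_add, inner_add_left]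
  smul_left f g a := by rw [map_smul, inner_smul_left]

theorem norm_def (f : μ.HardySpace hD) : ‖f‖ = ‖equivLp f‖ := rfl

theorem hasSum_norm_sq (f : μ.HardySpace hD) :
    HasSum (fun k => ‖coeff f k‖ ^ 2 / μ.ω k) (‖f‖ ^ 2) := by
  have := lp.hasSum_norm (by simp) (equivLp f)
  rw [← norm_def] at this
  convert this using 2 with k
  · change _ = ‖coeff f k / _‖ ^ _
    simp [div_pow, Real.sq_sqrt (μ.ω_pos k).le, abs_of_nonneg (Real.sqrt_nonneg _)]
  · simp

instance : CompleteSpace (μ.HardySpace hD) :=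
  (LinearIsometryEquiv.mk equivLp fun _ => rfl :
    μ.HardySpace hD ≃ₗᵢ[ℂ] lp (fun _ : Fin n → ℕ => ℂ) 2).toIsometryEquiv.completeSpace

theorem exists_norm_apply_le (z : μ.domain) :
    ∃ C : ℝ, ∀ f : μ.HardySpace hD, ‖toFun f z‖ ≤ C * ‖f‖ := by
  obtain ⟨z, C, hC⟩ := z
  refine ⟨|C|, fun f => ?_⟩
  refine le_of_tendsto ((coeff_spec f).2 ⟨z, C, hC⟩).norm (Filter.Eventually.of_forall fun K => ?_)
  calc ‖∑ k ∈ K, coeff f k * monomial z k‖ ≤ C * √(∑ k ∈ K, ‖coeff f k‖ ^ 2 / μ.ω k) :=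
        μ.norm_sum_le hC _ K
    _ ≤ |C| * √(‖f‖ ^ 2) := by
        gcongr
        · exact le_abs_self C
        · exact sum_le_hasSum _ (fun k _ => by have := μ.ω_pos k; positivity) (hasSum_norm_sq f)
    _ = |C| * ‖f‖ := by rw [Real.sqrt_sq (norm_nonneg _)]

/-- `H²(D(𝛍))` is a reproducing kernel Hilbert space of functions on `D(𝛍)`. -/
instance : RKHS ℂ (μ.HardySpace hD) μ.domain ℂ where
  coeCLM := ⟨toFun, continuous_pi fun z => by
    obtain ⟨C, hC⟩ := exists_norm_apply_le (hD := hD) z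
    exact (LinearMap.mkContinuous (LinearMap.proj z ∘ₗ toFun) C hC).continuous⟩
  coeCLM_injective := toFun_injective

end HardySpace

/-! ### Multipliers -/

section Multiplier

variable {X : Type*} (H : Type*) [NormedAddCommGroup H] [InnerProductSpace ℂ H] [RKHS ℂ H X ℂ]

/-- The multiplier algebra `M(H)` of a Hilbert function space `H`: the functions `φ` with
`φ f ∈ H` for all `f ∈ H`. -/
def multiplierAlgebra : Subalgebra ℂ (X → ℂ) where
  carrier := {φ | ∀ f : H, ∃ g : H, ∀ x, g x = φ x * f x}
  mul_mem' := by
    intro φ ψ hφ hψ f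
    obtain ⟨g, hg⟩ := hψ f
    obtain ⟨h, hh⟩ := hφ g
    exact ⟨h, fun x => by rw [hh, hg, Pi.mul_apply, mul_assoc]⟩
  add_mem' := by
    intro φ ψ hφ hψ f
    obtain ⟨g, hg⟩ := hφ f
    obtain ⟨h, hh⟩ := hψ f
    exact ⟨g + h, fun x => by simp [hg, hh, add_mul]⟩
  algebraMap_mem' := fun a f => ⟨a • f, fun x => by simp⟩

variable {H}

/-- The element `φ f` of `H`. -/
def mulFun (φ : multiplierAlgebra (X := X) H) (f : H) : H := Classical.choose (φ.2 f)

theorem mulFun_apply (φ : multiplierAlgebra (X := X) H) (f : H) (x : X) :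
    mulFun φ f x = (φ : X → ℂ) x * f x :=
  Classical.choose_spec (φ.2 f) x

/-- The multiplication operator `M_φ f = φ f`; it is bounded by the closed graph theorem. Its
operator norm is the multiplier norm of `φ`. -/
def mulOperator [CompleteSpace H] (φ : multiplierAlgebra (X := X) H) : H →L[ℂ] H :=
  ContinuousLinearMap.ofSeqClosedGraph
    (g := { toFun := mulFun φ
            map_add' := fun f g => RKHS.ext fun x => by
              simp [mulFun_apply, mul_add]
            map_smul' := fun a f => RKHS.ext fun x => by
              simp [mulFun_apply, mul_left_comm] })
    (fun u f g hu hg => RKHS.ext fun x => by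
      have h1 := ((RKHS.continuous_eval (H := H) x).tendsto g).comp hg
      have h2 := (((RKHS.continuous_eval (H := H) x).tendsto f).comp hu).const_mul
        ((φ : X → ℂ) x)
      refine tendsto_nhds_unique h1 ?_
      change Filter.Tendsto _ _ (𝓝 (mulFun φ f x))
      rw [mulFun_apply]
      exact h2.congr fun j => (mulFun_apply φ (u j) x).symm)

theorem mulOperator_apply [CompleteSpace H] (φ : multiplierAlgebra (X := X) H) (f : H) (x : X) :
    mulOperator φ f x = (φ : X → ℂ) x * f x :=
  mulFun_apply φ f x

end Multiplier

/-! ### Fourier representations -/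

namespace WeightSequence

variable {n : ℕ} (μ : WeightSequence n)

/-- `∑_k c_k B^k` is the Fourier representation of `A`: `A 1 = ∑_k c_k y^{(k)}`. -/
def IsFourierRepresentation (A : μ.symFock →L[ℂ] μ.symFock) (c : (Fin n → ℕ) → ℂ) : Prop :=
  HasSum (fun k => c k • μ.y k) (A (μ.y 0))

/-- The Cesàro mean `∑_{|k| ≤ N} (1 - |k| / (N + 1)) c_k B^k`. -/
def cesaro (c : (Fin n → ℕ) → ℂ) (N : ℕ) : μ.symFock →L[ℂ] μ.symFock :=
  ∑ k ∈ (Fintype.piFinset fun _ : Fin n => Finset.range (N + 1)) with ∑ i, k i ≤ N,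
    ((1 - (∑ i, k i : ℕ) / (N + 1 : ℝ) : ℝ) * c k : ℂ) • μ.Bpow k

end WeightSequence

end WeightedFock

end

/-!
In the orthonormal basis `√ω_k y^{(k)}`, passing from `A` to the Cesàro means of its Fourier
representation multiplies each matrix entry by the Fejér kernel at the degrees of its row and
column. That kernel is the Gram matrix of unit vectors in `ℓ²(ℕ)`, so this does not increase the
operator norm. Hence, for every `A` commuting with all `B_i`, the Cesàro means are bounded by `‖A‖`
and converge strongly, thus ultraweakly, to `A`: the Hardy algebra is the commutant of
`B_1, …, B_n`. Under `U` an operator in the commutant becomes multiplication by the image of `A 1`,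
and multiplication operators commute with multiplication by the coordinate functions.
-/

noncomputable section

namespace WeightedFock

/-! ### Schur multipliers with a Gram kernel -/

section Schur

variable {𝕜 E H K ι κ σ : Type*} [RCLike 𝕜]
  [NormedAddCommGroup E] [InnerProductSpace 𝕜 E] [NormedAddCommGroup H] [InnerProductSpace 𝕜 H]
  [NormedAddCommGroup K] [InnerProductSpace 𝕜 K]

theorem norm_sum_smul_sq_of_orthonormal {b : ι → H} (hb : Orthonormal 𝕜 b) (x : ι → 𝕜)
    (S : Finset ι) : ‖∑ p ∈ S, x p • b p‖ ^ 2 = ∑ p ∈ S, ‖x p‖ ^ 2 := by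
  simpa using hb.orthogonalFamily.norm_sum x S

theorem exists_orthonormal_sum_inner_mul_inner (S : Finset E) :
    ∃ (m : ℕ) (u : Fin m → E), Orthonormal 𝕜 u ∧
      ∀ x ∈ S, ∀ y, ∑ s, ⟪y, u s⟫_𝕜 * ⟪u s, x⟫_𝕜 = ⟪y, x⟫_𝕜 := by
  let u := stdOrthonormalBasis 𝕜 (Submodule.span 𝕜 (S : Set E))
  refine ⟨_, fun s => u s,
    u.orthonormal.comp_linearIsometry (Submodule.span 𝕜 (S : Set E)).subtypeₗᵢ,
    fun x hx y => ?_⟩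
  have h := congrArg Subtype.val (u.sum_repr' ⟨x, Submodule.subset_span hx⟩)
  rw [Submodule.coe_sum] at h
  have h' := congrArg (fun w => ⟪y, w⟫_𝕜) h
  simpa only [inner_sum, Submodule.coe_smul, inner_smul_right, Submodule.coe_inner,
    mul_comm] using h'

theorem sum_norm_sum_inner_smul_sq_le [Fintype σ] {u : σ → E} (hu : Orthonormal 𝕜 u) {b : ι → H}
    (hb : Orthonormal 𝕜 b) {v : ι → E} (hv : ∀ p, ‖v p‖ ≤ 1) (x : ι → 𝕜) (S : Finset ι) :
    ∑ s, ‖∑ p ∈ S, (⟪u s, v p⟫_𝕜 * x p) • b p‖ ^ 2 ≤ ‖∑ p ∈ S, x p • b p‖ ^ 2 := by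
  simp only [norm_sum_smul_sq_of_orthonormal hb, norm_mul, mul_pow]
  rw [Finset.sum_comm]
  refine Finset.sum_le_sum fun p _ => ?_
  rw [← Finset.sum_mul]
  refine mul_le_of_le_one_left (by positivity) ((hu.sum_inner_products_le (v p)).trans ?_)
  exact pow_le_one₀ (norm_nonneg _) (hv p)

variable {b : HilbertBasis ι 𝕜 H} {c : HilbertBasis κ 𝕜 K} {v : ι → E} {w : κ → E}
  {A C : H →L[𝕜] K}

theorem norm_inner_sum_apply_sum_le (hv : ∀ p, ‖v p‖ ≤ 1) (hw : ∀ q, ‖w q‖ ≤ 1)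
    (h : ∀ p q, ⟪c q, C (b p)⟫_𝕜 = ⟪w q, v p⟫_𝕜 * ⟪c q, A (b p)⟫_𝕜)
    (x : ι → 𝕜) (y : κ → 𝕜) (S : Finset ι) (T : Finset κ) :
    ‖⟪∑ q ∈ T, y q • c q, C (∑ p ∈ S, x p • b p)⟫_𝕜‖ ≤
      ‖A‖ * ‖∑ p ∈ S, x p • b p‖ * ‖∑ q ∈ T, y q • c q‖ := by
  classical
  -- Expanding each `⟪w q, v p⟫` in an orthonormal family `u` turns the form of `C` into a sum over
  -- `u` of forms of `A`, to which Cauchy–Schwarz and Bessel's inequality apply.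
  obtain ⟨m, u, hu, hsum⟩ := exists_orthonormal_sum_inner_mul_inner (𝕜 := 𝕜) (S.image v)
  let f s := ∑ p ∈ S, (⟪u s, v p⟫_𝕜 * x p) • b p
  let g s := ∑ q ∈ T, (⟪u s, w q⟫_𝕜 * y q) • c q
  have split : ⟪∑ q ∈ T, y q • c q, C (∑ p ∈ S, x p • b p)⟫_𝕜 = ∑ s, ⟪g s, A (f s)⟫_𝕜 := by
    simp only [f, g, map_sum, map_smul, sum_inner, inner_sum, inner_smul_left, inner_smul_right,
      map_mul, inner_conj_symm, h]
    simp only [Finset.mul_sum]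
    rw [Finset.sum_comm (s := .univ)]
    refine Finset.sum_congr rfl fun p hp => ?_
    rw [Finset.sum_comm (s := .univ)]
    refine Finset.sum_congr rfl fun q _ => ?_
    rw [← hsum _ (Finset.mem_image_of_mem v hp) (w q), Finset.sum_mul, Finset.mul_sum,
      Finset.mul_sum]
    exact Finset.sum_congr rfl fun s _ => by ring
  calc ‖⟪∑ q ∈ T, y q • c q, C (∑ p ∈ S, x p • b p)⟫_𝕜‖ ≤ ∑ s, ‖A‖ * (‖f s‖ * ‖g s‖) := by
        rw [split]
        refine norm_sum_le_of_le _ fun s _ => (norm_inner_le_norm _ _).trans ?_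
        calc ‖g s‖ * ‖A (f s)‖ ≤ ‖g s‖ * (‖A‖ * ‖f s‖) := by gcongr; exact A.le_opNorm _
          _ = ‖A‖ * (‖f s‖ * ‖g s‖) := by ring
    _ ≤ ‖A‖ * (√(∑ s, ‖f s‖ ^ 2) * √(∑ s, ‖g s‖ ^ 2)) := by
        rw [← Finset.mul_sum]
        gcongr
        exact Real.sum_mul_le_sqrt_mul_sqrt _ _ _
    _ ≤ ‖A‖ * (‖∑ p ∈ S, x p • b p‖ * ‖∑ q ∈ T, y q • c q‖) := by
        gcongr <;> refine (Real.sqrt_le_left (norm_nonneg _)).2 ?_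
        · exact sum_norm_sum_inner_smul_sq_le hu b.orthonormal hv x S
        · exact sum_norm_sum_inner_smul_sq_le hu c.orthonormal hw y T
    _ = _ := (mul_assoc _ _ _).symm

theorem norm_le_of_inner_eq_inner_mul_inner (hv : ∀ p, ‖v p‖ ≤ 1) (hw : ∀ q, ‖w q‖ ≤ 1)
    (h : ∀ p q, ⟪c q, C (b p)⟫_𝕜 = ⟪w q, v p⟫_𝕜 * ⟪c q, A (b p)⟫_𝕜) : ‖C‖ ≤ ‖A‖ := by
  have key : ∀ (f : H) (g : K), ‖⟪g, C f⟫_𝕜‖ ≤ ‖A‖ * ‖f‖ * ‖g‖ := by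
    intro f g
    have hf := (b.hasSum_repr f).comp (Filter.tendsto_fst (g := Filter.atTop (α := Finset κ)))
    have hg := (c.hasSum_repr g).comp (Filter.tendsto_snd (f := Filter.atTop (α := Finset ι)))
    exact le_of_tendsto_of_tendsto' (hg.inner ((C.continuous.tendsto f).comp hf)).norm
      ((hf.norm.const_mul ‖A‖).mul hg.norm)
      fun P => norm_inner_sum_apply_sum_le hv hw h _ _ P.1 P.2
  refine ContinuousLinearMap.opNorm_le_of_re_inner_le (𝕜 := 𝕜) (norm_nonneg A) fun f g hf hg => ?_
  have := key f g
  rw [hf, hg, norm_inner_symm, mul_one, mul_one] at this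
  exact (RCLike.re_le_norm _).trans this

end Schur

section StrongLimits

variable {𝕜 H K κ α : Type*} [RCLike 𝕜] [NormedAddCommGroup H] [NormedSpace 𝕜 H]
  [NormedAddCommGroup K] [InnerProductSpace 𝕜 K] {l : Filter α}

theorem tendsto_apply_of_dense_span {C : α → H →L[𝕜] K} {A : H →L[𝕜] K} {M : ℝ}
    (hC : ∀ N, ‖C N‖ ≤ M) {s : Set H} (hs : Dense (Submodule.span 𝕜 s : Set H))
    (h : ∀ x ∈ s, Filter.Tendsto (fun N => C N x) l (𝓝 (A x))) (x : H) :
    Filter.Tendsto (fun N => C N x) l (𝓝 (A x)) := by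
  have hequi : Equicontinuous fun N => (C N : H → K) :=
    ((NormedSpace.equicontinuous_TFAE C).out 5 1).1 (Exists.intro M hC)
  refine hs.induction (fun x hx => ?_) (hequi.isClosed_setOfPred_tendsto A.continuous) x
  induction hx using Submodule.span_induction with
  | zero => simpa only [map_zero] using tendsto_const_nhds
  | add x y _ _ hx hy => simpa only [map_add] using hx.add hy
  | smul a x _ hx => simpa only [map_smul] using hx.const_smul a
  | mem x hx => exact h x hx

theorem hasSum_norm_inner_sq (c : HilbertBasis κ 𝕜 K) (y : K) :
    HasSum (fun q => ‖⟪c q, y⟫_𝕜‖ ^ 2) (‖y‖ ^ 2) := by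
  simpa [c.repr_apply_apply] using lp.hasSum_norm (p := 2) (by simp) (c.repr y)

theorem tendsto_of_inner_eq_mul_inner (c : HilbertBasis κ 𝕜 K) {k : α → κ → 𝕜} {x : α → K} {y : K}
    (hk : ∀ N q, ‖k N q‖ ≤ 1) (hlim : ∀ q, Filter.Tendsto (fun N => k N q) l (𝓝 1))
    (h : ∀ N q, ⟪c q, x N⟫_𝕜 = k N q * ⟪c q, y⟫_𝕜) : Filter.Tendsto x l (𝓝 y) := by
  have hdiff : ∀ N q, ‖⟪c q, x N - y⟫_𝕜‖ ^ 2 = ‖k N q - 1‖ ^ 2 * ‖⟪c q, y⟫_𝕜‖ ^ 2 := by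
    intro N q
    rw [inner_sub_right, h, ← sub_one_mul, norm_mul, mul_pow]
  have hbound : ∀ N q, ‖⟪c q, x N - y⟫_𝕜‖ ^ 2 ≤ 2 ^ 2 * ‖⟪c q, y⟫_𝕜‖ ^ 2 := by
    intro N q
    rw [hdiff]
    gcongr
    refine (norm_sub_le _ _).trans ?_
    rw [norm_one]
    linarith [hk N q]
  have hzero : ∀ q, Filter.Tendsto (fun N => ‖⟪c q, x N - y⟫_𝕜‖ ^ 2) l (𝓝 0) := by
    intro q
    simpa [hdiff] using (((hlim q).sub_const 1).norm.pow 2).mul_const (‖⟪c q, y⟫_𝕜‖ ^ 2)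
  have hsum := tendsto_tsum_of_dominated_convergence
    ((hasSum_norm_inner_sq c y).summable.mul_left (2 ^ 2)) hzero
    (.of_forall fun N q => by simpa using hbound N q)
  simp only [(hasSum_norm_inner_sq c _).tsum_eq, tsum_zero] at hsum
  rw [tendsto_iff_norm_sub_tendsto_zero]
  simpa using hsum.sqrt

end StrongLimits

/-! ### Fejér means -/

section Fejer

/-- The Fejér kernel `(1 - |l - m| / (N + 1))⁺`, encoded as the proportion of the window
`{m, …, m + N}` that it shares with `{l, …, l + N}`; this makes it a Gram matrix. -/
def fejerKernel (N m l : ℕ) : ℝ :=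
  (Finset.Icc m (m + N) ∩ Finset.Icc l (l + N)).card / (N + 1)

theorem fejerKernel_comm (N m l : ℕ) : fejerKernel N m l = fejerKernel N l m := by
  rw [fejerKernel, fejerKernel, Finset.inter_comm]

theorem fejerKernel_add (N m k : ℕ) :
    fejerKernel N m (k + m) = if k ≤ N then 1 - k / (N + 1 : ℝ) else 0 := by
  have hinter : Finset.Icc m (m + N) ∩ Finset.Icc (k + m) (k + m + N) =
      Finset.Icc (k + m) (m + N) := by
    ext x
    simp only [Finset.mem_inter, Finset.mem_Icc]
    omega
  rw [fejerKernel, hinter, Nat.card_Icc]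
  split_ifs with hk
  · rw [show m + N + 1 - (k + m) = N + 1 - k by omega, Nat.cast_sub (by omega)]
    push_cast
    field_simp
  · rw [show m + N + 1 - (k + m) = 0 by omega, Nat.cast_zero, zero_div]

theorem tendsto_fejerKernel (m l : ℕ) :
    Filter.Tendsto (fun N => fejerKernel N m l) Filter.atTop (𝓝 1) := by
  wlog h : m ≤ l generalizing m l
  · simpa only [fejerKernel_comm _ m l] using this l m (le_of_not_ge h)
  obtain ⟨k, rfl⟩ := Nat.exists_eq_add_of_le' h
  have hlim : Filter.Tendsto (fun N : ℕ => 1 - (k : ℝ) / (N + 1 : ℝ)) Filter.atTop (𝓝 1) := by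
    simpa using ((tendsto_const_div_atTop_nhds_zero_nat (k : ℝ)).comp
      (Filter.tendsto_add_atTop_nat 1)).const_sub 1
  refine hlim.congr' ?_
  filter_upwards [Filter.eventually_ge_atTop k] with N hN
  rw [fejerKernel_add, if_pos hN]

variable (𝕜 : Type*) [RCLike 𝕜]

/-- The normalized indicator of the window `{m, …, m + N}` in `ℓ²(ℕ)`. -/
def windowVector (N m : ℕ) : lp (fun _ : ℕ => 𝕜) 2 :=
  (((√(N + 1))⁻¹ : ℝ) : 𝕜) • ∑ s ∈ Finset.Icc m (m + N), lp.single 2 s 1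

theorem inner_windowVector (N m l : ℕ) :
    ⟪windowVector 𝕜 N m, windowVector 𝕜 N l⟫_𝕜 = fejerKernel N m l := by
  have hsq : (√(N + 1 : ℝ))⁻¹ * (√(N + 1 : ℝ))⁻¹ = (N + 1 : ℝ)⁻¹ := by
    rw [← mul_inv, Real.mul_self_sqrt (by positivity)]
  have hcard : ⟪∑ s ∈ Finset.Icc m (m + N), (lp.single 2 s 1 : lp (fun _ : ℕ => 𝕜) 2),
      ∑ s ∈ Finset.Icc l (l + N), (lp.single 2 s 1 : lp (fun _ : ℕ => 𝕜) 2)⟫_𝕜 =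
      (Finset.Icc m (m + N) ∩ Finset.Icc l (l + N)).card := by
    simp [sum_inner, inner_sum, lp.inner_single_left, lp.single_apply, Pi.single_apply,
      Finset.inter_comm, -Finset.mem_Icc]
  rw [windowVector, windowVector, inner_smul_left, inner_smul_right, hcard, RCLike.conj_ofReal,
    ← mul_assoc, ← RCLike.ofReal_mul, hsq, fejerKernel, div_eq_inv_mul]
  push_cast
  rfl

theorem norm_windowVector (N m : ℕ) : ‖windowVector 𝕜 N m‖ = 1 := by
  have h := inner_windowVector 𝕜 N m m
  have hdiag : fejerKernel N m m = 1 := by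
    simpa using fejerKernel_add N m 0
  rw [hdiag, inner_self_eq_norm_sq_to_K] at h
  exact (pow_eq_one_iff_of_nonneg (norm_nonneg _) two_ne_zero).1 (by exact_mod_cast h)

variable {𝕜} {H K ι κ : Type*} [NormedAddCommGroup H] [InnerProductSpace 𝕜 H]
  [NormedAddCommGroup K] [InnerProductSpace 𝕜 K] {b : HilbertBasis ι 𝕜 H} {c : HilbertBasis κ 𝕜 K}
  {A : H →L[𝕜] K} {d : ι → ℕ} {d' : κ → ℕ}

theorem norm_le_of_inner_eq_fejerKernel_mul {C : H →L[𝕜] K} {N : ℕ}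
    (h : ∀ p q, ⟪c q, C (b p)⟫_𝕜 = fejerKernel N (d p) (d' q) * ⟪c q, A (b p)⟫_𝕜) :
    ‖C‖ ≤ ‖A‖ :=
  norm_le_of_inner_eq_inner_mul_inner (fun p => (norm_windowVector 𝕜 N (d p)).le)
    (fun q => (norm_windowVector 𝕜 N (d' q)).le)
    (by simpa only [inner_windowVector, fejerKernel_comm N (d' _)] using h)

theorem tendsto_of_inner_eq_fejerKernel_mul {C : ℕ → H →L[𝕜] K}
    (h : ∀ N p q, ⟪c q, C N (b p)⟫_𝕜 = fejerKernel N (d p) (d' q) * ⟪c q, A (b p)⟫_𝕜) (f : H) :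
    Filter.Tendsto (fun N => C N f) Filter.atTop (𝓝 (A f)) := by
  refine tendsto_apply_of_dense_span (fun N => norm_le_of_inner_eq_fejerKernel_mul (h N))
    (Submodule.dense_iff_topologicalClosure_eq_top.2 b.dense_span) ?_ f
  rintro _ ⟨p, rfl⟩
  refine tendsto_of_inner_eq_mul_inner c (fun N q => ?_) (fun q => ?_) fun N q => h N p q
  · rw [← inner_windowVector]
    simpa only [norm_windowVector, mul_one] using
      norm_inner_le_norm (𝕜 := 𝕜) (windowVector 𝕜 N (d p)) (windowVector 𝕜 N (d' q))
  · rw [← RCLike.ofReal_one]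
    exact (RCLike.continuous_ofReal.tendsto 1).comp (tendsto_fejerKernel (d p) (d' q))

end Fejer

/-! ### The ultraweak topology -/

section Ultraweak

variable {H α : Type*} [NormedAddCommGroup H] [InnerProductSpace ℂ H]

theorem tendsto_ultraweakTopology {l : Filter α} {C : α → H →L[ℂ] H} {A : H →L[ℂ] H} {M : ℝ}
    (hC : ∀ N, ‖C N‖ ≤ M) (h : ∀ x, Filter.Tendsto (fun N => C N x) l (𝓝 (A x))) :
    Filter.Tendsto C l (@nhds _ (ultraweakTopology H) A) := by
  simp only [nhds_iInf, nhds_induced, Filter.tendsto_iInf, Filter.tendsto_comap_iff]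
  intro x y
  have hx : Summable fun j => ‖x j‖ ^ 2 := by simpa using (lp.memℓp x).summable (by simp)
  have hy : Summable fun j => ‖y j‖ ^ 2 := by simpa using (lp.memℓp y).summable (by simp)
  refine tendsto_tsum_of_dominated_convergence ((hx.add hy).mul_left M)
    (fun j => tendsto_const_nhds.inner (h (x j))) (.of_forall fun N j => ?_)
  have hM : 0 ≤ M := (norm_nonneg _).trans (hC N)
  have hCx := (C N).le_of_opNorm_le (hC N) (x j)
  calc ‖⟪y j, C N (x j)⟫_ℂ‖ ≤ ‖y j‖ * (M * ‖x j‖) := (norm_inner_le_norm _ _).trans (by gcongr)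
    _ = M * (‖x j‖ * ‖y j‖) := by ring
    _ ≤ M * (‖x j‖ ^ 2 + ‖y j‖ ^ 2) := by
      gcongr
      nlinarith [two_mul_le_add_sq ‖x j‖ ‖y j‖, norm_nonneg (x j), norm_nonneg (y j)]

theorem continuous_ultraweakTopology_inner (x y : H) :
    Continuous[ultraweakTopology H, inferInstance] fun T : H →L[ℂ] H => ⟪y, T x⟫_ℂ := by
  have hsingle : (fun T : H →L[ℂ] H => ⟪y, T x⟫_ℂ) = fun T : H →L[ℂ] H =>
      ∑' j, ⟪(lp.single 2 0 y : lp (fun _ : ℕ => H) 2) j,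
        T ((lp.single 2 0 x : lp (fun _ : ℕ => H) 2) j)⟫_ℂ := by
    funext T
    rw [tsum_eq_single 0 fun j hj => by simp [lp.single_apply, hj]]
    simp
  rw [hsingle, continuous_iff_le_induced]
  exact (iInf_le _ (lp.single 2 0 x : lp (fun _ : ℕ => H) 2)).trans
    (iInf_le _ (lp.single 2 0 y : lp (fun _ : ℕ => H) 2))

theorem isClosed_ultraweakTopology_centralizer [CompleteSpace H] (S : Set (H →L[ℂ] H)) :
    IsClosed[ultraweakTopology H] S.centralizer := by
  have hinter : S.centralizer = ⋂ B ∈ S, ⋂ (x : H) (y : H),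
      {T | ⟪B.adjoint y, T x⟫_ℂ = ⟪y, T (B x)⟫_ℂ} := by
    ext T
    simp only [Set.mem_centralizer_iff, Set.mem_iInter, Set.mem_ofPred_eq,
      ContinuousLinearMap.adjoint_inner_left]
    refine forall₂_congr fun B _ => ⟨fun h x y => ?_, fun h => ?_⟩
    · exact congrArg (fun R : H →L[ℂ] H => ⟪y, R x⟫_ℂ) h
    · exact ContinuousLinearMap.ext fun x => ext_inner_left ℂ (h x)
  rw [hinter]
  let := ultraweakTopology H
  exact isClosed_biInter fun B _ => isClosed_iInter fun x => isClosed_iInter fun y =>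
    isClosed_eq (continuous_ultraweakTopology_inner x _) (continuous_ultraweakTopology_inner _ y)

end Ultraweak

/-! ### The symmetric weighted Fock space -/

theorem inner_e_e {n : ℕ} (α β : List (Fin n)) :
    ⟪(e α : Fock n), e β⟫_ℂ = if α = β then 1 else 0 := by
  rw [e, lp.inner_single_left, e, lp.single_apply, Pi.single_apply]
  split_ifs <;> simp

theorem count_cons_eq_add_single {n : ℕ} (i : Fin n) (α : List (Fin n)) :
    (fun j => (i :: α).count j) = (fun j => α.count j) + Pi.single i 1 := by
  ext j
  rw [List.count_cons, Pi.add_apply, Pi.single_apply]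
  simp only [beq_iff_eq, eq_comm (a := i)]

namespace WeightSequence

variable {n : ℕ} (μ : WeightSequence n)

/-- The vector `𝛍(α, g_0) e_α`, which is the monomial `Z_α` applied to the weighted shifts and
evaluated at the vacuum vector. -/
def wordVector (α : List (Fin n)) : Fock n := (μ.prod α : ℂ) • e α

theorem W_wordVector (i : Fin n) (α : List (Fin n)) :
    μ.W i (μ.wordVector α) = μ.wordVector (i :: α) := by
  have hprod : μ.prod (i :: α) = μ.toFun (i :: α) * μ.prod α := rfl
  rw [wordVector, map_smul, W_e, smul_smul, wordVector, hprod]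
  push_cast
  rw [mul_comm]

-- `y^{(k)}` is the average of the vectors `wordVector α`, `α ∈ Λ_k`, with weights `𝛍(α, g_0)⁻²`.
theorem map_yFock_eq {k : Fin n → ℕ} (φ : Fock n →L[ℂ] ℂ) {a : ℂ}
    (h : ∀ α, (fun i => α.count i) = k → φ (μ.wordVector α) = a) : φ (μ.yFock k) = a := by
  have hω : (μ.ω k : ℂ) ≠ 0 := by exact_mod_cast (μ.ω_pos k).ne'
  have hφ : ∀ α ∈ LamFinset k, φ ((1 / μ.prod α : ℂ) • e α) = (1 / μ.prod α ^ 2 : ℂ) * a := by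
    intro α hα
    have hprod : (μ.prod α : ℂ) ≠ 0 := by exact_mod_cast (μ.prod_pos α).ne'
    rw [← h α (mem_LamFinset.1 hα), wordVector, map_smul, map_smul, smul_eq_mul, smul_eq_mul]
    field_simp
  have hsum : ∑ α ∈ LamFinset k, (1 / μ.prod α ^ 2 : ℂ) = μ.ω k := by
    simp only [ω, Complex.ofReal_sum, Complex.ofReal_div, Complex.ofReal_one, Complex.ofReal_pow]
  rw [yFock, map_smul, map_sum, Finset.sum_congr rfl hφ, ← Finset.sum_mul, hsum, smul_eq_mul]
  field_simp

theorem inner_yFock_wordVector (l : Fin n → ℕ) (α : List (Fin n)) :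
    ⟪μ.yFock l, μ.wordVector α⟫_ℂ =
      if l = fun i => α.count i then (1 / μ.ω l : ℂ) else 0 := by
  have hprod : (μ.prod α : ℂ) ≠ 0 := by exact_mod_cast (μ.prod_pos α).ne'
  simp only [yFock, wordVector, inner_smul_left, inner_smul_right, sum_inner, inner_e_e, mul_ite,
    mul_one, mul_zero, Finset.sum_ite_eq', mem_LamFinset, eq_comm (a := l)]
  split_ifs
  · simp only [map_div₀, map_one, Complex.conj_ofReal]
    field_simp
  · rfl

theorem inner_y_y (l k : Fin n → ℕ) :
    ⟪μ.y l, μ.y k⟫_ℂ = if l = k then (1 / μ.ω l : ℂ) else 0 :=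
  μ.map_yFock_eq (innerSL ℂ (μ.yFock l)) fun α hα => by
    rw [innerSL_apply_apply, inner_yFock_wordVector, hα]

theorem eq_of_forall_inner_y {f g : μ.symFock} (h : ∀ k, ⟪μ.y k, f⟫_ℂ = ⟪μ.y k, g⟫_ℂ) :
    f = g := by
  have hle : μ.symFock ≤ (ℂ ∙ (f - g : Fock n))ᗮ := by
    refine Submodule.topologicalClosure_minimal _ (Submodule.span_le.2 ?_)
      (Submodule.isClosed_orthogonal _)
    rintro _ ⟨k, rfl⟩
    rw [SetLike.mem_coe, Submodule.mem_orthogonal_singleton_iff_inner_left, inner_sub_right,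
      sub_eq_zero]
    exact h k
  have hfg := Submodule.mem_orthogonal_singleton_iff_inner_left.1 (hle (f - g).2)
  exact sub_eq_zero.1 (Subtype.ext (inner_self_eq_zero.1 hfg))

theorem inner_y_B (l : Fin n → ℕ) (i : Fin n) (f : μ.symFock) :
    ⟪μ.y l, μ.B i f⟫_ℂ = ⟪μ.yFock l, μ.W i f⟫_ℂ := by
  rw [B, ContinuousLinearMap.comp_apply, Submodule.inner_orthogonalProjectionOnto_eq_of_mem_left]
  rfl

theorem B_y (i : Fin n) (k : Fin n → ℕ) : μ.B i (μ.y k) = μ.y (k + Pi.single i 1) := by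
  refine μ.eq_of_forall_inner_y fun l => ?_
  rw [inner_y_B, inner_y_y]
  refine μ.map_yFock_eq (innerSL ℂ (μ.yFock l) ∘L μ.W i) fun α hα => ?_
  rw [ContinuousLinearMap.comp_apply, innerSL_apply_apply, W_wordVector, inner_yFock_wordVector,
    count_cons_eq_add_single, hα]

theorem B_pow_y (i : Fin n) (m : ℕ) (p : Fin n → ℕ) :
    (μ.B i ^ m) (μ.y p) = μ.y (p + Pi.single i m) := by
  induction m with
  | zero => simp
  | succ m ih => rw [pow_succ', mul_apply_eq_comp, ih, B_y, add_assoc, ← Pi.single_add]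

theorem prod_map_B_pow_y (L : List (Fin n)) (k p : Fin n → ℕ) :
    (L.map fun i => μ.B i ^ k i).prod (μ.y p) =
      μ.y ((L.map fun i => Pi.single i (k i)).sum + p) := by
  induction L with
  | nil => simp
  | cons i L ih =>
    simp only [List.map_cons, List.prod_cons, List.sum_cons, mul_apply_eq_comp, ih, B_pow_y]
    rw [add_right_comm, add_comm (List.sum _)]

theorem Bpow_y (k p : Fin n → ℕ) : μ.Bpow k (μ.y p) = μ.y (k + p) := by
  rw [Bpow, prod_map_B_pow_y, ← List.ofFn_eq_map, List.sum_ofFn, Finset.univ_sum_single]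

theorem Bpow_mem {S : Subalgebra ℂ (μ.symFock →L[ℂ] μ.symFock)} (hS : ∀ i, μ.B i ∈ S)
    (k : Fin n → ℕ) : μ.Bpow k ∈ S := by
  refine list_prod_mem fun T hT => ?_
  obtain ⟨i, -, rfl⟩ := List.mem_map.1 hT
  exact pow_mem (hS i) _

theorem cesaro_mem {S : Subalgebra ℂ (μ.symFock →L[ℂ] μ.symFock)} (hS : ∀ i, μ.B i ∈ S)
    (c : (Fin n → ℕ) → ℂ) (N : ℕ) : μ.cesaro c N ∈ S :=
  sum_mem fun k _ => S.smul_mem (μ.Bpow_mem hS k) _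

theorem ω_ne_zero (k : Fin n → ℕ) : (μ.ω k : ℂ) ≠ 0 := by
  exact_mod_cast (μ.ω_pos k).ne'

theorem sqrt_ω_ne_zero (k : Fin n → ℕ) : (√(μ.ω k) : ℂ) ≠ 0 := by
  exact_mod_cast (Real.sqrt_pos.2 (μ.ω_pos k)).ne'

theorem sqrt_ω_mul_self (k : Fin n → ℕ) : (√(μ.ω k) * √(μ.ω k) : ℂ) = μ.ω k := by
  exact_mod_cast Real.mul_self_sqrt (μ.ω_pos k).le

theorem inner_sqrt_ω_smul_y (k : Fin n → ℕ) (f : μ.symFock) :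
    ⟪(√(μ.ω k) : ℂ) • μ.y k, f⟫_ℂ = √(μ.ω k) * ⟪μ.y k, f⟫_ℂ := by
  rw [inner_smul_left (μ.y k) f, Complex.conj_ofReal]

theorem orthonormal_sqrt_ω_smul_y : Orthonormal ℂ fun k => (√(μ.ω k) : ℂ) • μ.y k := by
  refine orthonormal_iff_ite.2 fun l k => ?_
  rw [inner_sqrt_ω_smul_y, inner_smul_right (μ.y l) (μ.y k), inner_y_y]
  split_ifs with h
  · rw [← h, ← mul_assoc, sqrt_ω_mul_self, mul_one_div_cancel (μ.ω_ne_zero l)]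
  · simp

/-- The orthonormal basis `√ω_k y^{(k)}` of the symmetric weighted Fock space. -/
def basis : HilbertBasis (Fin n → ℕ) ℂ μ.symFock :=
  HilbertBasis.mkOfOrthogonalEqBot μ.orthonormal_sqrt_ω_smul_y <|
    (Submodule.eq_bot_iff _).2 fun f hf => μ.eq_of_forall_inner_y fun k => by
      have h := (Submodule.mem_orthogonal _ _).1 hf _ (Submodule.subset_span ⟨k, rfl⟩)
      rw [inner_sqrt_ω_smul_y] at h
      rw [inner_zero_right, (mul_eq_zero.1 h).resolve_left (μ.sqrt_ω_ne_zero k)]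

theorem basis_apply (k : Fin n → ℕ) : μ.basis k = (√(μ.ω k) : ℂ) • μ.y k := by
  rw [basis, HilbertBasis.coe_mkOfOrthogonalEqBot]

theorem dense_span_y : Dense (Submodule.span ℂ (Set.range μ.y) : Set μ.symFock) := by
  refine (Submodule.dense_iff_topologicalClosure_eq_top.2 μ.basis.dense_span).mono ?_
  refine Submodule.span_le.2 ?_
  rintro _ ⟨k, rfl⟩
  rw [basis_apply]
  exact Submodule.smul_mem _ _ (Submodule.subset_span ⟨k, rfl⟩)

theorem hasSum_inner_y_smul_y (f : μ.symFock) :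
    HasSum (fun k => (μ.ω k * ⟪μ.y k, f⟫_ℂ) • μ.y k) f := by
  refine (μ.basis.hasSum_repr f).congr_fun fun k => ?_
  rw [μ.basis.repr_apply_apply, basis_apply, inner_sqrt_ω_smul_y, smul_smul, mul_right_comm,
    sqrt_ω_mul_self]

theorem inner_y_of_hasSum {c : (Fin n → ℕ) → ℂ} {f : μ.symFock}
    (h : HasSum (fun k => c k • μ.y k) f) (k : Fin n → ℕ) : μ.ω k * ⟪μ.y k, f⟫_ℂ = c k := by
  have hterm : ∀ l, μ.ω k * innerSL ℂ (μ.y k) (c l • μ.y l) = if l = k then c k else 0 := by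
    intro l
    rw [map_smul, innerSL_apply_apply, inner_y_y, smul_eq_mul]
    simp only [eq_comm (a := k)]
    split_ifs with hl
    · rw [hl, mul_left_comm, mul_one_div_cancel (μ.ω_ne_zero k), mul_one]
    · rw [mul_zero, mul_zero]
  exact ((h.mapL (innerSL ℂ (μ.y k))).mul_left (μ.ω k : ℂ)).unique
    ((hasSum_ite_eq k (c k)).congr_fun hterm)

theorem existsUnique_hasSum_y (f : μ.symFock) :
    ∃! c : (Fin n → ℕ) → ℂ, HasSum (fun k => c k • μ.y k) f :=
  ⟨_, μ.hasSum_inner_y_smul_y f, fun _ hc => funext fun k => (μ.inner_y_of_hasSum hc k).symm⟩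

theorem hasSum_cesaro_y (c : (Fin n → ℕ) → ℂ) (N : ℕ) (p : Fin n → ℕ) :
    HasSum (fun k => (fejerKernel N (∑ i, p i) (∑ i, (k + p) i) * c k : ℂ) • μ.Bpow k (μ.y p))
      (μ.cesaro c N (μ.y p)) := by
  have hkernel : ∀ k : Fin n → ℕ, fejerKernel N (∑ i, p i) (∑ i, (k + p) i) =
      if ∑ i, k i ≤ N then 1 - (∑ i, k i : ℕ) / (N + 1 : ℝ) else 0 := fun k => by
    simp only [Pi.add_apply, Finset.sum_add_distrib, fejerKernel_add]
  have hsum : μ.cesaro c N (μ.y p) =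
      ∑ k ∈ (Fintype.piFinset fun _ : Fin n => Finset.range (N + 1)) with ∑ i, k i ≤ N,
        (fejerKernel N (∑ i, p i) (∑ i, (k + p) i) * c k : ℂ) • μ.Bpow k (μ.y p) := by
    rw [cesaro, sum_apply]
    refine Finset.sum_congr rfl fun k hk => ?_
    rw [smul_apply, hkernel, if_pos (Finset.mem_filter.1 hk).2]
  rw [hsum]
  refine hasSum_sum_of_ne_finset_zero fun k hk => ?_
  have hk' : ¬ ∑ i, k i ≤ N := fun hle => hk <| Finset.mem_filter.2
    ⟨Fintype.mem_piFinset.2 fun i => Finset.mem_range_succ_iff.2 <|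
      (Finset.single_le_sum (fun _ _ => Nat.zero_le _) (Finset.mem_univ i)).trans hle, hle⟩
  rw [hkernel, if_neg hk', Complex.ofReal_zero, zero_mul, zero_smul]

theorem inner_basis_cesaro {A : μ.symFock →L[ℂ] μ.symFock} {c : (Fin n → ℕ) → ℂ}
    (hA : ∀ p, HasSum (fun k => c k • μ.Bpow k (μ.y p)) (A (μ.y p))) (N : ℕ) (p q : Fin n → ℕ) :
    ⟪μ.basis q, μ.cesaro c N (μ.basis p)⟫_ℂ =
      fejerKernel N (∑ i, p i) (∑ i, q i) * ⟪μ.basis q, A (μ.basis p)⟫_ℂ := by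
  have hterm : ∀ k, innerSL ℂ (μ.y q)
      ((fejerKernel N (∑ i, p i) (∑ i, (k + p) i) * c k : ℂ) • μ.Bpow k (μ.y p)) =
        fejerKernel N (∑ i, p i) (∑ i, q i) * innerSL ℂ (μ.y q) (c k • μ.Bpow k (μ.y p)) := by
    intro k
    rw [map_smul, map_smul, smul_eq_mul, smul_eq_mul, innerSL_apply_apply, Bpow_y, inner_y_y]
    split_ifs with h
    · rw [h, mul_assoc]
    · simp only [mul_zero]
  have hinner := ((μ.hasSum_cesaro_y c N p).mapL (innerSL ℂ (μ.y q))).unique <|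
    (((hA p).mapL (innerSL ℂ (μ.y q))).mul_left _).congr_fun hterm
  rw [innerSL_apply_apply, innerSL_apply_apply] at hinner
  simp only [basis_apply, map_smul, inner_sqrt_ω_smul_y]
  rw [inner_smul_right (μ.y q) (μ.cesaro c N (μ.y p)), inner_smul_right (μ.y q) (A (μ.y p)),
    hinner]
  ring

/-! ### The commutant of the compressed shifts -/

theorem B_comm (i j : Fin n) : μ.B i * μ.B j = μ.B j * μ.B i := by
  refine ContinuousLinearMap.ext_on μ.dense_span_y ?_
  rintro _ ⟨k, rfl⟩
  rw [mul_apply_eq_comp, mul_apply_eq_comp, B_y, B_y, B_y, B_y, add_right_comm]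

/-- The commutant of `B_1, …, B_n`. -/
def commutant : Subalgebra ℂ (μ.symFock →L[ℂ] μ.symFock) :=
  Subalgebra.centralizer ℂ (Set.range μ.B)

theorem mem_commutant {A : μ.symFock →L[ℂ] μ.symFock} :
    A ∈ μ.commutant ↔ ∀ i, μ.B i * A = A * μ.B i := by
  rw [commutant, Subalgebra.mem_centralizer_iff, Set.forall_mem_range]

variable {μ} {A A' : μ.symFock →L[ℂ] μ.symFock} {c : (Fin n → ℕ) → ℂ}

theorem apply_y_of_mem_commutant (hA : A ∈ μ.commutant) (p : Fin n → ℕ) :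
    A (μ.y p) = μ.Bpow p (A (μ.y 0)) := by
  have hcomm : A * μ.Bpow p = μ.Bpow p * A := by
    have hB : ∀ i, μ.B i ∈ Subalgebra.centralizer ℂ {A} := fun i =>
      (Subalgebra.mem_centralizer_iff ℂ).2 fun _ hT => hT ▸ (μ.mem_commutant.1 hA i).symm
    exact (Subalgebra.mem_centralizer_iff ℂ).1 (μ.Bpow_mem hB p) A rfl
  calc A (μ.y p) = (A * μ.Bpow p) (μ.y 0) := by rw [mul_apply_eq_comp, Bpow_y, add_zero]
    _ = μ.Bpow p (A (μ.y 0)) := by rw [hcomm, mul_apply_eq_comp]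

theorem eq_of_mem_commutant (hA : A ∈ μ.commutant) (hA' : A' ∈ μ.commutant)
    (h : A (μ.y 0) = A' (μ.y 0)) : A = A' := by
  refine ContinuousLinearMap.ext_on μ.dense_span_y ?_
  rintro _ ⟨p, rfl⟩
  rw [apply_y_of_mem_commutant hA, apply_y_of_mem_commutant hA', h]

namespace IsFourierRepresentation

theorem hasSum_apply_y (hA : A ∈ μ.commutant) (hc : μ.IsFourierRepresentation A c)
    (p : Fin n → ℕ) : HasSum (fun k => c k • μ.Bpow k (μ.y p)) (A (μ.y p)) := by
  rw [apply_y_of_mem_commutant hA]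
  refine (hc.mapL (μ.Bpow p)).congr_fun fun k => ?_
  rw [map_smul, Bpow_y, Bpow_y, add_comm]

theorem norm_cesaro_le (hA : A ∈ μ.commutant) (hc : μ.IsFourierRepresentation A c) (N : ℕ) :
    ‖μ.cesaro c N‖ ≤ ‖A‖ :=
  norm_le_of_inner_eq_fejerKernel_mul (μ.inner_basis_cesaro (hc.hasSum_apply_y hA) N)

theorem tendsto_cesaro (hA : A ∈ μ.commutant) (hc : μ.IsFourierRepresentation A c)
    (f : μ.symFock) : Filter.Tendsto (fun N => μ.cesaro c N f) Filter.atTop (𝓝 (A f)) :=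
  tendsto_of_inner_eq_fejerKernel_mul (μ.inner_basis_cesaro (hc.hasSum_apply_y hA)) f

end IsFourierRepresentation

variable (μ)

theorem hardyAlgebra_eq_commutant : μ.hardyAlgebra = μ.commutant := by
  refine le_antisymm (sInf_le ⟨fun i => ?_, ?_⟩) fun A hA => Algebra.mem_sInf.2 fun S hS => ?_
  · exact μ.mem_commutant.2 fun j => μ.B_comm j i
  · exact isClosed_ultraweakTopology_centralizer _
  · obtain ⟨c, hc, -⟩ := μ.existsUnique_hasSum_y (A (μ.y 0))
    have hc : μ.IsFourierRepresentation A c := hc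
    let := ultraweakTopology μ.symFock
    exact hS.2.mem_of_tendsto
      (tendsto_ultraweakTopology (hc.norm_cesaro_le hA) (hc.tendsto_cesaro hA))
      (.of_forall fun N => μ.cesaro_mem hS.1 c N)

end WeightSequence

/-! ### The multiplier algebra -/

section MulOperator

variable {X H : Type*} [NormedAddCommGroup H] [InnerProductSpace ℂ H] [RKHS ℂ H X ℂ]
  [CompleteSpace H]

variable (X H) in
/-- The representation `φ ↦ M_φ` of the multiplier algebra. -/
def mulOperatorHom : multiplierAlgebra (X := X) H →ₐ[ℂ] H →L[ℂ] H :=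
  AlgHom.ofLinearMap
    { toFun := mulOperator
      map_add' := fun φ ψ => ContinuousLinearMap.ext fun f => RKHS.ext fun x => by
        simp [mulOperator_apply, add_mul]
      map_smul' := fun a φ => ContinuousLinearMap.ext fun f => RKHS.ext fun x => by
        simp [mulOperator_apply, mul_assoc] }
    (ContinuousLinearMap.ext fun f => RKHS.ext fun x => by simp [mulOperator_apply])
    fun φ ψ => ContinuousLinearMap.ext fun f => RKHS.ext fun x => by
      simp [mulOperator_apply, mul_assoc]

theorem mulOperatorHom_apply (φ : multiplierAlgebra (X := X) H) :
    mulOperatorHom X H φ = mulOperator φ := rfl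

theorem mulOperatorHom_injective (h : ∀ x : X, ∃ f : H, f x ≠ 0) :
    Function.Injective (mulOperatorHom X H) := by
  refine fun φ ψ hφψ => Subtype.ext (funext fun x => ?_)
  obtain ⟨f, hf⟩ := h x
  have hx := congrArg (fun T : H →L[ℂ] H => T f x) hφψ
  simp only [mulOperatorHom_apply, mulOperator_apply] at hx
  exact mul_right_cancel₀ hf hx

theorem mem_range_mulOperatorHom {T : H →L[ℂ] H} :
    T ∈ (mulOperatorHom X H).range ↔ ∃ φ : X → ℂ, ∀ f x, T f x = φ x * f x := by
  constructor
  · rintro ⟨φ, rfl⟩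
    exact ⟨φ, mulOperator_apply φ⟩
  · rintro ⟨φ, hφ⟩
    refine ⟨⟨φ, fun f => ⟨T f, hφ f⟩⟩, ContinuousLinearMap.ext fun f => RKHS.ext fun x => ?_⟩
    exact (mulOperator_apply _ f x).trans (hφ f x).symm

theorem commute_of_mem_range_mulOperatorHom {S T : H →L[ℂ] H}
    (hS : S ∈ (mulOperatorHom X H).range) (hT : T ∈ (mulOperatorHom X H).range) :
    S * T = T * S := by
  obtain ⟨φ, rfl⟩ := hS
  obtain ⟨ψ, rfl⟩ := hT
  rw [← map_mul, mul_comm, map_mul]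

end MulOperator

theorem monomial_zero {n : ℕ} (z : Fin n → ℂ) : monomial z 0 = 1 := by
  simp [monomial]

theorem monomial_add {n : ℕ} (z : Fin n → ℂ) (k l : Fin n → ℕ) :
    monomial z (k + l) = monomial z k * monomial z l := by
  simp only [monomial, Pi.add_apply, pow_add, Finset.prod_mul_distrib]

theorem monomial_single {n : ℕ} (z : Fin n → ℂ) (i : Fin n) :
    monomial z (Pi.single i 1) = z i := by
  simp [monomial, Pi.single_apply]

namespace WeightSequence

variable {n : ℕ} (μ : WeightSequence n) (hD : μ.domain ∈ 𝓝 (0 : Fin n → ℂ))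

/-- The unitary operator from the symmetric weighted Fock space onto `H²(D(𝛍))` that maps
`y^{(k)}` to the monomial `λ^k`. -/
def toHardy : μ.symFock ≃ₗᵢ[ℂ] μ.HardySpace hD :=
  μ.basis.repr.trans (LinearIsometryEquiv.mk HardySpace.equivLp fun _ => rfl :
    μ.HardySpace hD ≃ₗᵢ[ℂ] lp (fun _ : Fin n → ℕ => ℂ) 2).symm

theorem coeff_toHardy (f : μ.symFock) (k : Fin n → ℕ) :
    HardySpace.coeff (μ.toHardy hD f) k = μ.ω k * ⟪μ.y k, f⟫_ℂ := by
  have hrepr : HardySpace.equivLp (μ.toHardy hD f) = μ.basis.repr f :=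
    LinearEquiv.apply_symm_apply _ _
  have hk : HardySpace.coeff (μ.toHardy hD f) k / √(μ.ω k) = μ.basis.repr f k :=
    congrArg (fun v : lp (fun _ : Fin n → ℕ => ℂ) 2 => v k) hrepr
  rw [(div_eq_iff (μ.sqrt_ω_ne_zero k)).1 hk, μ.basis.repr_apply_apply, basis_apply,
    inner_sqrt_ω_smul_y, mul_right_comm, sqrt_ω_mul_self]

theorem toHardy_apply_hasSum {c : (Fin n → ℕ) → ℂ} {f : μ.symFock}
    (h : HasSum (fun k => c k • μ.y k) f) (z : μ.domain) :
    HasSum (fun k => c k * monomial z.1 k) (μ.toHardy hD f z) := by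
  have hc : HardySpace.coeff (μ.toHardy hD f) = c :=
    funext fun k => (μ.coeff_toHardy hD f k).trans (μ.inner_y_of_hasSum h k)
  exact hc ▸ (HardySpace.coeff_spec (μ.toHardy hD f)).2 z

theorem toHardy_y (k : Fin n → ℕ) (z : μ.domain) :
    μ.toHardy hD (μ.y k) z = monomial z.1 k := by
  have hy : HasSum (fun l => (Pi.single k 1 : (Fin n → ℕ) → ℂ) l • μ.y l) (μ.y k) := by
    refine (hasSum_ite_eq k (μ.y k)).congr_fun fun l => ?_
    rw [Pi.single_apply, ite_smul, one_smul, zero_smul]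
    split_ifs with h
    · rw [h]
    · rfl
  refine (μ.toHardy_apply_hasSum hD hy z).unique ?_
  refine (hasSum_ite_eq k (monomial z.1 k)).congr_fun fun l => ?_
  rw [Pi.single_apply, ite_mul, one_mul, zero_mul]
  split_ifs with h
  · rw [h]
  · rfl

/-- Evaluation at a point of the domain, as a functional on the symmetric weighted Fock space. -/
def evalAt (z : μ.domain) : μ.symFock →L[ℂ] ℂ :=
  ContinuousLinearMap.proj (R := ℂ) (φ := fun _ : μ.domain => ℂ) z ∘L
    RKHS.coeCLM ℂ ∘L (μ.toHardy hD).toContinuousLinearEquiv.toContinuousLinearMap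

theorem toHardy_Bpow (k : Fin n → ℕ) (f : μ.symFock) (z : μ.domain) :
    μ.toHardy hD (μ.Bpow k f) z = monomial z.1 k * μ.toHardy hD f z := by
  have h : μ.evalAt hD z ∘L μ.Bpow k = monomial z.1 k • μ.evalAt hD z := by
    refine ContinuousLinearMap.ext_on μ.dense_span_y ?_
    rintro _ ⟨p, rfl⟩
    change μ.toHardy hD (μ.Bpow k (μ.y p)) z = monomial z.1 k * μ.toHardy hD (μ.y p) z
    rw [Bpow_y, toHardy_y, toHardy_y, monomial_add]
  exact congrArg (fun T => T f) h

theorem toHardy_apply_of_mem_commutant {A : μ.symFock →L[ℂ] μ.symFock} (hA : A ∈ μ.commutant)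
    (f : μ.symFock) (z : μ.domain) :
    μ.toHardy hD (A f) z = μ.toHardy hD (A (μ.y 0)) z * μ.toHardy hD f z := by
  have h : μ.evalAt hD z ∘L A = μ.toHardy hD (A (μ.y 0)) z • μ.evalAt hD z := by
    refine ContinuousLinearMap.ext_on μ.dense_span_y ?_
    rintro _ ⟨p, rfl⟩
    change μ.toHardy hD (A (μ.y p)) z =
      μ.toHardy hD (A (μ.y 0)) z * μ.toHardy hD (μ.y p) z
    rw [apply_y_of_mem_commutant hA, toHardy_Bpow, toHardy_y, mul_comm]
  exact congrArg (fun T => T f) h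

/-- The algebra isomorphism `A ↦ U A U⁻¹` implemented by the unitary `toHardy`. -/
def conjToHardy : (μ.symFock →L[ℂ] μ.symFock) ≃ₐ[ℂ] (μ.HardySpace hD →L[ℂ] μ.HardySpace hD) :=
  (μ.toHardy hD).toContinuousLinearEquiv.conjContinuousAlgEquiv.toAlgEquiv

theorem conjToHardy_apply (A : μ.symFock →L[ℂ] μ.symFock) (f : μ.HardySpace hD) :
    μ.conjToHardy hD A f = μ.toHardy hD (A ((μ.toHardy hD).symm f)) := rfl

theorem norm_conjToHardy (A : μ.symFock →L[ℂ] μ.symFock) : ‖μ.conjToHardy hD A‖ = ‖A‖ :=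
  (ContinuousLinearMap.opNorm_linearIsometryEquiv_comp (μ.toHardy hD) _).trans
    (A.opNorm_comp_linearIsometryEquiv (μ.toHardy hD).symm)

theorem conjToHardy_mem_range_of_mem_commutant {A : μ.symFock →L[ℂ] μ.symFock}
    (hA : A ∈ μ.commutant) :
    μ.conjToHardy hD A ∈ (mulOperatorHom μ.domain (μ.HardySpace hD)).range := by
  refine mem_range_mulOperatorHom.2 ⟨μ.toHardy hD (A (μ.y 0)), fun f z => ?_⟩
  rw [conjToHardy_apply, toHardy_apply_of_mem_commutant μ hD hA,
    LinearIsometryEquiv.apply_symm_apply]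

theorem conjToHardy_mem_range_iff {A : μ.symFock →L[ℂ] μ.symFock} :
    μ.conjToHardy hD A ∈ (mulOperatorHom μ.domain (μ.HardySpace hD)).range ↔
      A ∈ μ.commutant := by
  refine ⟨fun hA => μ.mem_commutant.2 fun i => (μ.conjToHardy hD).injective ?_,
    μ.conjToHardy_mem_range_of_mem_commutant hD⟩
  have hB : μ.B i ∈ μ.commutant := μ.mem_commutant.2 fun j => μ.B_comm j i
  rw [map_mul, map_mul, commute_of_mem_range_mulOperatorHom
    (μ.conjToHardy_mem_range_of_mem_commutant hD hB) hA]

theorem map_conjToHardy_hardyAlgebra :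
    μ.hardyAlgebra.map (μ.conjToHardy hD).toAlgHom =
      (mulOperatorHom μ.domain (μ.HardySpace hD)).range := by
  rw [hardyAlgebra_eq_commutant]
  refine le_antisymm ?_ fun T hT => ?_
  · rintro _ ⟨A, hA, rfl⟩
    exact μ.conjToHardy_mem_range_of_mem_commutant hD hA
  · obtain ⟨A, rfl⟩ := (μ.conjToHardy hD).surjective T
    exact ⟨A, (μ.conjToHardy_mem_range_iff hD).1 hT, rfl⟩

theorem mulOperatorHom_hardySpace_injective :
    Function.Injective (mulOperatorHom μ.domain (μ.HardySpace hD)) :=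
  mulOperatorHom_injective fun z => ⟨μ.toHardy hD (μ.y 0), by
    rw [toHardy_y, monomial_zero]
    exact one_ne_zero⟩

/-- The isomorphism of the Hardy algebra onto the multiplier algebra that sends `A` to the function
`φ` with `U A U⁻¹ = M_φ`. -/
def symbolEquiv : μ.hardyAlgebra ≃ₐ[ℂ] multiplierAlgebra (μ.HardySpace hD) :=
  (((μ.conjToHardy hD).subalgebraMap μ.hardyAlgebra).trans
    (Subalgebra.equivOfEq _ _ (μ.map_conjToHardy_hardyAlgebra hD))).trans
    (AlgEquiv.ofInjective _ (μ.mulOperatorHom_hardySpace_injective hD)).symm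

theorem mulOperator_symbolEquiv (A : μ.hardyAlgebra) :
    mulOperator (μ.symbolEquiv hD A) =
      μ.conjToHardy hD (A : μ.symFock →L[ℂ] μ.symFock) :=
  congrArg Subtype.val (AlgEquiv.apply_symm_apply
    (AlgEquiv.ofInjective _ (μ.mulOperatorHom_hardySpace_injective hD)) _)

theorem toHardy_apply_eq_mulOperator (A : μ.hardyAlgebra) (f : μ.symFock) :
    μ.toHardy hD ((A : μ.symFock →L[ℂ] μ.symFock) f) =
      mulOperator (μ.symbolEquiv hD A) (μ.toHardy hD f) := by
  rw [mulOperator_symbolEquiv, conjToHardy_apply, LinearIsometryEquiv.symm_apply_apply]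

theorem norm_mulOperator_symbolEquiv (A : μ.hardyAlgebra) :
    ‖mulOperator (μ.symbolEquiv hD A)‖ = ‖(A : μ.symFock →L[ℂ] μ.symFock)‖ := by
  rw [mulOperator_symbolEquiv, norm_conjToHardy]

theorem symbolEquiv_apply (A : μ.hardyAlgebra) (z : μ.domain) :
    (μ.symbolEquiv hD A : μ.domain → ℂ) z =
      μ.toHardy hD ((A : μ.symFock →L[ℂ] μ.symFock) (μ.y 0)) z := by
  rw [toHardy_apply_eq_mulOperator, mulOperator_apply, toHardy_y, monomial_zero, mul_one]

end WeightSequence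

end WeightedFock

end

open WeightedFock in
theorem theorem6p3 {n : ℕ} (μ : WeightSequence n) (hD : μ.domain ∈ 𝓝 (0 : Fin n → ℂ)) :
    ∃ (U : μ.symFock ≃ₗᵢ[ℂ] μ.HardySpace hD)
      (Ψ : μ.hardyAlgebra ≃ₐ[ℂ] multiplierAlgebra (μ.HardySpace hD)),
      -- `U` is the unitary operator with `U y^{(k)} = λ^k`
      (∀ (k : Fin n → ℕ) (z : μ.domain), U (μ.y k) z = monomial z.1 k) ∧
      -- under `U`, each `A` in the Hardy algebra becomes multiplication by `Ψ A`
      (∀ (A : μ.hardyAlgebra) (f : μ.symFock),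
        U ((A : μ.symFock →L[ℂ] μ.symFock) f) = mulOperator (Ψ A) (U f)) ∧
      -- the identification is isometric for the multiplier norm
      (∀ A : μ.hardyAlgebra, ‖mulOperator (Ψ A)‖ = ‖(A : μ.symFock →L[ℂ] μ.symFock)‖) ∧
      -- `B_i` corresponds to the coordinate function `λ_i`
      (∀ (i : Fin n) (z : μ.domain), (Ψ ⟨μ.B i, μ.B_mem i⟩ : μ.domain → ℂ) z = z.1 i) ∧
      -- every element has exactly one Fourier representation
      (∀ A : μ.hardyAlgebra,
        ∃! c : (Fin n → ℕ) → ℂ, μ.IsFourierRepresentation A c) ∧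
      -- an element is determined by its Fourier representation
      (∀ (A A' : μ.hardyAlgebra) (c : (Fin n → ℕ) → ℂ),
        μ.IsFourierRepresentation A c → μ.IsFourierRepresentation A' c → A = A') ∧
      -- the Fourier representation of `A`
      (∀ (A : μ.hardyAlgebra) (c : (Fin n → ℕ) → ℂ), μ.IsFourierRepresentation A c →
        -- acts as `A` on the vectors `y^{(p)}`
        (∀ p : Fin n → ℕ, HasSum (fun k => c k • μ.Bpow k (μ.y p))
          ((A : μ.symFock →L[ℂ] μ.symFock) (μ.y p))) ∧
        -- is the power series of the multiplier `Ψ A`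
        (∀ z : μ.domain, HasSum (fun k => c k * monomial z.1 k)
          ((Ψ A : μ.domain → ℂ) z)) ∧
        -- and its Cesaro means converge to `A` in the strong operator topology
        (∀ f : μ.symFock, Filter.Tendsto (fun N => μ.cesaro c N f) Filter.atTop
          (𝓝 ((A : μ.symFock →L[ℂ] μ.symFock) f)))) := by
  have hmem : ∀ A : μ.hardyAlgebra, (A : μ.symFock →L[ℂ] μ.symFock) ∈ μ.commutant :=
    fun A => μ.hardyAlgebra_eq_commutant ▸ A.2
  refine ⟨μ.toHardy hD, μ.symbolEquiv hD, μ.toHardy_y hD, μ.toHardy_apply_eq_mulOperator hD,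
    μ.norm_mulOperator_symbolEquiv hD, fun i z => ?_, fun A => μ.existsUnique_hasSum_y _,
    fun A A' c hA hA' => ?_, fun A c hA => ⟨hA.hasSum_apply_y (hmem A), fun z => ?_,
      hA.tendsto_cesaro (hmem A)⟩⟩
  · rw [μ.symbolEquiv_apply, μ.B_y, μ.toHardy_y, zero_add, monomial_single]
  · exact Subtype.ext (WeightSequence.eq_of_mem_commutant (hmem A) (hmem A') (hA.unique hA'))
  · rw [μ.symbolEquiv_apply]
    exact μ.toHardy_apply_hasSum hD hA z
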